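/- Let $n,m\ge 0$ be integers and $q=\max(n,m)$. In the two-user symmetric linear deterministic interference channel the inputs $X_{1j},X_{2j}\in\mathbb F_2^q$ at time $j$ (first coordinate most significant) produce the outputs $$Y_{1j}=S^{q-n}X_{1j}\oplus S^{q-m}X_{2j},\qquad Y_{2j}=S^{q-n}X_{2j}\oplus S^{q-m}X_{1j},$$ where $S$ is the $q\times q$ down-shift matrix. In the $(1000)$ feedback model only receiver 1 feeds its output back, strictly causally and without noise, to transmitter 1, so that $X_{1j}=f_{1j}(W_1,Y_{11},\dots,Y_{1,j-1})$ and $X_{2j}=f_{2j}(W_2)$; receiver $u$ forms $\widehat W_u=h_u(Y_{u1},\dots,Y_{uN})$. A rate pair $(R_1,R_2)$ with $R_1,R_2\ge 0$ is achievable if there are codes of all block lengths $N$, with independent messages $W_u$ uniform on $\{1,\dots,2^{NR_u}\}$ (the integers in $[1,2^{NR_u}]$), for which $\max_u\Pr(\widehat W_u\neq W_u)\to 0$ as $N\to\infty$. The capacity region $\mathcal C^{(1000)}\subset\mathbb R^2$ is the closure of the set of achievable rate pairs. **Theorem.** The region $\mathcal C^{(1000)}$ is exactly the set of all $(R_1,R_2)$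 with $R_1,R_2\ge 0$ and $$R_1\le n,\qquad R_2\le\max(n,m),\qquad R_1+R_2\le (n-m)^++\max(n,m),$$ $$2R_1+R_2\le (n-m)^++\max(n,m)+\max(n-m,m).$$ Moreover, every corner point (extreme point) of $\mathcal C^{(1000)}$ is achieved by a relay scheme: there is a relay scheme, in the sense below, whose code with $L+1$ blocks makes no decoding error for any message pair, for every $L\ge 0$, and whose rate pairs converge to the corner point as $L\to\infty$. Here a relay scheme consists of numbers $k_1,k_2,r\ge 0$, a layout for each transmitter, and extraction and decoding maps. It works over $L+1$ blocks of one channel use each. Transmitter 1 has $k_1$ fresh message bits in every block but the first; transmitter 2 has $k_2$ fresh message bits and $r$ fresh relay bits (also part of its message) in every block but the last; bits not present are $0$. According to the fixed layouts, each of the $q$ levels of $X_1$ carries $0$, a fresh bit of transmitter 1, or one of the $r$ relay bits of transmitter 2 from the preceding block, and each level of $X_2$ carries $0$, a fresh bit or a relay bit of transmitter 2. Transmitter 1 obtains the relay bits of a block by a fixed map from the fed-back output of receiver 1 in that block and the bits that transmitter 1 itself sent in it. Each receiver processes the blocks one at a time, either forward or backward, applying one fixed map in every block to the output of that block and a state in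 $\mathbb F_2^r$ (initially zero), which gives the decoded bits of the block and the next state. -/

import Mathlib

namespace FeedbackIC

/-- Channel inputs and outputs: vectors in `𝔽₂^q`, index `0` being the most significant level. -/
abbrev Signal (q : ℕ) : Type := Fin q → ZMod 2

/-- The down-shift `S^d` on `𝔽₂^q`: level `i` of the result is level `i - d` of the argument,
and the top `d` levels of the result vanish. -/
def shift {q : ℕ} (d : ℕ) (x : Signal q) : Signal q :=
  fun i => if d ≤ (i : ℕ) then x ⟨(i : ℕ) - d, by omega⟩ else 0

/-- Output of a receiver of the symmetric deterministic interference channel, `q = max n m`: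
`S^(q-n)` applied to the input of its own transmitter plus
`S^(q-m)` applied to the input of the other one. -/
def receive (n m : ℕ) (own other : Signal (max n m)) : Signal (max n m) :=
  shift (max n m - n) own + shift (max n m - m) other

/-- A code of length `N` for the feedback model `(1000)`: at time `j` transmitter 1 knows its
message and the outputs of receiver 1 at the times `i < j`, transmitter 2 only its message. -/
structure Code (n m N : ℕ) (M₁ M₂ : Type) where
  enc₁ : (j : Fin N) → M₁ → (Fin (j : ℕ) → Signal (max n m)) → Signal (max n m)
  enc₂ : Fin N → M₂ → Signal (max n m)
  dec₁ : (Fin N → Signal (max n m)) → M₁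
  dec₂ : (Fin N → Signal (max n m)) → M₂

namespace Code

variable {n m N : ℕ} {M₁ M₂ : Type}

/-- Output of receiver 1 at time `j` when the messages are `w₁` and `w₂`. -/
def out₁ (c : Code n m N M₁ M₂) (w₁ : M₁) (w₂ : M₂) (j : Fin N) : Signal (max n m) :=
  receive n m
    (c.enc₁ j w₁ (fun i => c.out₁ w₁ w₂ ⟨(i : ℕ), i.isLt.trans j.isLt⟩))
    (c.enc₂ j w₂)
termination_by (j : ℕ)
decreasing_by exact i.isLt

/-- Input of transmitter 1 at time `j`. -/
def in₁ (c : Code n m N M₁ M₂) (w₁ : M₁) (w₂ : M₂) (j : Fin N) : Signal (max n m) :=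
  c.enc₁ j w₁ (fun i => c.out₁ w₁ w₂ ⟨(i : ℕ), i.isLt.trans j.isLt⟩)

/-- Output of receiver 2 at time `j`. -/
def out₂ (c : Code n m N M₁ M₂) (w₁ : M₁) (w₂ : M₂) (j : Fin N) : Signal (max n m) :=
  receive n m (c.enc₂ j w₂) (c.in₁ w₁ w₂ j)

/-- Probability that receiver 1 errs, the messages being independent and uniform. -/
noncomputable def errProb₁ (c : Code n m N M₁ M₂) : ℝ :=
  (Nat.card {w : M₁ × M₂ // c.dec₁ (c.out₁ w.1 w.2) ≠ w.1} : ℝ) / (Nat.card (M₁ × M₂) : ℝ)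

/-- Probability that receiver 2 errs, the messages being independent and uniform. -/
noncomputable def errProb₂ (c : Code n m N M₁ M₂) : ℝ :=
  (Nat.card {w : M₁ × M₂ // c.dec₂ (c.out₂ w.1 w.2) ≠ w.2} : ℝ) / (Nat.card (M₁ × M₂) : ℝ)

/-- Both receivers decode every message pair correctly. -/
def ErrorFree (c : Code n m N M₁ M₂) : Prop :=
  ∀ w₁ w₂, c.dec₁ (c.out₁ w₁ w₂) = w₁ ∧ c.dec₂ (c.out₂ w₁ w₂) = w₂

/-- Rate pair of a code, in bits per channel use. -/
noncomputable def rates (_ : Code n m N M₁ M₂) : ℝ × ℝ :=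
  (Real.logb 2 (Nat.card M₁) / N, Real.logb 2 (Nat.card M₂) / N)

end Code

/-- The message set `{1, …, 2^(N R)}`: as many elements as there are integers in `[1, 2^(N R)]`. -/
abbrev Message (N : ℕ) (R : ℝ) : Type := Fin ⌊(2 : ℝ) ^ ((N : ℝ) * R)⌋₊

/-- Achievable rate pairs of the feedback model `(1000)`. -/
def Achievable (n m : ℕ) (R : ℝ × ℝ) : Prop :=
  0 ≤ R.1 ∧ 0 ≤ R.2 ∧
    ∃ c : (N : ℕ) → Code n m N (Message N R.1) (Message N R.2),
      Filter.Tendsto (fun N => max (c N).errProb₁ (c N).errProb₂) Filter.atTop (nhds 0)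

/-- The capacity region `𝒞^(1000)`. -/
def capacityRegion (n m : ℕ) : Set (ℝ × ℝ) := closure {R | Achievable n m R}

/-- The order in which a receiver processes the blocks. -/
inductive Direction
  | forward
  | backward

/-- A receiver that processes the blocks `0, 1, …, N - 1` in this order, one at a time. Its only
memory is a state in `𝔽₂^r`, initially zero: from the output of a block and the state, `step`
computes the result for this block and the next state. -/
def runState {q r N : ℕ} {O : Type} (step : Signal q → Signal r → O × Signal r)
    (y : Fin N → Signal q) : (i : ℕ) → i ≤ N → Signal r
  | 0, _ => 0
  | i + 1, h => (step (y ⟨i, h⟩) (runState step y i (Nat.le_of_succ_le h))).2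

/-- The result for block `i` of a blockwise receiver; with `backward` it starts with the last
block and ends with the first one. -/
def run {q r N : ℕ} {O : Type} (step : Signal q → Signal r → O × Signal r) :
    Direction → (Fin N → Signal q) → Fin N → O
  | .forward, y, i => (step (y i) (runState step y (i : ℕ) i.isLt.le)).1
  | .backward, y, i =>
      (step (y i) (runState step (fun j => y j.rev) (i.rev : ℕ) i.rev.isLt.le)).1

/-- The bits of a list of `L` blocks of bits, continued by zero (silence). -/
def block {ι : Type} {L : ℕ} (w : Fin L → ι → ZMod 2) (j : ℕ) : ι → ZMod 2 :=
  if h : j < L then w ⟨j, h⟩ else 0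

/-- As `block`, but delayed by one block, so that block `0` is silent. -/
def delayedBlock {ι : Type} {L : ℕ} (w : Fin L → ι → ZMod 2) : ℕ → ι → ZMod 2
  | 0 => 0
  | j + 1 => block w j

/-- A relay scheme. In each block (one channel use) transmitter 1 has `k₁` fresh bits and
transmitter 2 has `k₂` fresh bits and `r` fresh relay bits. Every signal level carries either `0`
(layout `none`) or one of these bits; the relay bits sent by transmitter 1 are those of
transmitter 2 in the preceding block, which transmitter 1 extracts from its feedback. -/
structure RelayScheme (n m : ℕ) where
  k₁ : ℕ
  k₂ : ℕ
  r : ℕ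
  /-- The bit carried by each level at transmitter 1: a fresh bit or a relayed bit. -/
  layout₁ : Fin (max n m) → Option (Fin k₁ ⊕ Fin r)
  /-- The bit carried by each level at transmitter 2: a fresh bit or a fresh relay bit. -/
  layout₂ : Fin (max n m) → Option (Fin k₂ ⊕ Fin r)
  /-- Extraction of the relay bits of transmitter 2 at transmitter 1, from the output of receiver 1
  in a block and the fresh and relayed bits sent by transmitter 1 in this block. -/
  extract : Signal (max n m) → Signal k₁ → Signal r → Signal r
  dir₁ : Direction
  /-- Receiver 1 decodes the fresh bits of transmitter 1. -/
  step₁ : Signal (max n m) → Signal r → Signal k₁ × Signal r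
  dir₂ : Direction
  /-- Receiver 2 decodes the fresh and the relay bits of transmitter 2. -/
  step₂ : Signal (max n m) → Signal r → (Fin k₂ ⊕ Fin r → ZMod 2) × Signal r

namespace RelayScheme

variable {n m : ℕ}

/-- The signal with a given layout that carries the given bits. -/
def fill {ι : Type} {q : ℕ} (layout : Fin q → Option ι) (b : ι → ZMod 2) : Signal q :=
  fun i => (layout i).elim 0 b

/-- The relay bits that transmitter 1 sends in block `j`, computed from its fresh bits `a` and
the feedback from the preceding blocks. -/
def relayed (S : RelayScheme n m) (a : ℕ → Signal S.k₁) :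
    (j : ℕ) → (Fin j → Signal (max n m)) → Signal S.r
  | 0, _ => 0
  | j + 1, past =>
      S.extract (past (Fin.last j)) (a j) (S.relayed a j (fun i => past i.castSucc))

/-- The code given by a relay scheme with `L + 1` blocks. Transmitter 1 is silent in the first
block, transmitter 2 in the last one, so that each message consists of `L` blocks of bits. -/
def code (S : RelayScheme n m) (L : ℕ) :
    Code n m (L + 1) (Fin L → Signal S.k₁) (Fin L → Fin S.k₂ ⊕ Fin S.r → ZMod 2) where
  enc₁ j w past :=
    fill S.layout₁ (Sum.elim (delayedBlock w j) (S.relayed (delayedBlock w) j past))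
  enc₂ j w := fill S.layout₂ (block w j)
  dec₁ y i := run S.step₁ S.dir₁ y i.succ
  dec₂ y i := run S.step₂ S.dir₂ y i.castSucc

end RelayScheme

end FeedbackIC

/-!
# The capacity region of the interference channel with feedback `(1000)`

Write `q = max n m`. The converse needs no entropies: it counts the message pairs that both
receivers decode correctly, a constant fraction of all pairs. The first three bounds say that such
a pair is determined by few bits. For one message 2, message 1 is determined by the `n` levels of
input 1 that reach receiver 1; message 2 is determined by the output of receiver 2; and a pair is
determined by the output of receiver 1 and the `n - m` lowest levels of input 2, because receiver 1
knows message 1, hence, thanks to the feedback structure, input 1 and the interference.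

For the bound on `2 R₁ + R₂`, let `T` be the set of messages 2 that are decoded together with at
least half of the messages 1, and `V` the set of interference sequences at receiver 1 that they
cause. Receiver 1 learns message 1 and the interference, so `|M₁| |V|` is at most about `2 ^ (q N)`
(`Code.card_le_of_injOn_interference`). Given the interference, `max (n - m) m` levels of output 2
and `n - m` levels of input 1 determine the pair, so `|M₁| |T|` is at most about `|V|` times
`2 ^ ((n - m + max (n - m) m) N)` (`Code.card_le_of_interference_mem`). In the product of the two
estimates `|V|` cancels (`Code.card_bounds`).

For the direct part, the bits of a block of a relay scheme enter linearly, so that the scheme is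
free of errors as soon as a vanishing output and vanishing known relay bits force the bits of the
block to vanish (`RelayScheme.exists_errorFree`). A receiver working backward knows the relay bits
of the block it processes, one working forward those of the preceding block. Every extreme point of
the polygon is one of a few explicit points, and for each of them there is a layout for which this
criterion can be checked level by level. Concatenation of error-free codes makes the closure of
their rate pairs convex (`convex_closure_errorFreeRates`), and these rates are approximated by
codes of every length (`achievable_smul`). By the Krein-Milman theorem the polygon, being compact
and convex, is the closed convex hull of its extreme points, hence contained in the capacity region.
-/

namespace FeedbackIC

/-! ### The shift and the levels it keeps -/

theorem shift_add {q : ℕ} (d : ℕ) (x y : Signal q) : shift d (x + y) = shift d x + shift d y := by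
  funext i
  by_cases h : d ≤ (i : ℕ) <;> simp [shift, h]

/-- `S^(q-p)` keeps exactly the top `p` levels. -/
theorem shift_eq_shift_iff {q p : ℕ} (hp : p ≤ q) {x y : Signal q} :
    shift (q - p) x = shift (q - p) y ↔ ∀ i : Fin q, (i : ℕ) < p → x i = y i := by
  constructor
  · intro h i hi
    have := congrFun h ⟨i + (q - p), by omega⟩
    simpa [shift] using this
  · intro h
    funext i
    unfold shift
    split_ifs with hi
    · exact h _ (by simp only; omega)
    · rfl

/-- The `t` levels of `x` from level `s` on, continued by zero. -/
def window {q : ℕ} (s t : ℕ) (x : Signal q) : Signal t :=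
  fun i => if h : s + (i : ℕ) < q then x ⟨s + i, h⟩ else 0

theorem apply_eq_of_window_eq {q s t : ℕ} {x y : Signal q} (h : window s t x = window s t y)
    (i : Fin q) (hs : s ≤ i) (ht : (i : ℕ) < s + t) : x i = y i := by
  have := congrFun h ⟨i - s, by omega⟩
  simpa [window, Nat.add_sub_cancel' hs] using this

theorem shift_eq_of_shift_eq_of_window_eq {n m : ℕ} {x y : Signal (max n m)}
    (hs : shift (max n m - m) x = shift (max n m - m) y)
    (hw : window m (n - m) x = window m (n - m) y) :
    shift (max n m - n) x = shift (max n m - n) y := by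
  rw [shift_eq_shift_iff (le_max_left n m)]
  rw [shift_eq_shift_iff (le_max_right n m)] at hs
  intro i hi
  by_cases him : (i : ℕ) < m
  · exact hs i him
  · exact apply_eq_of_window_eq hw i (by omega) (by omega)

/-- Given the interference that transmitter 2 causes, the output of receiver 2 is determined by
its lowest `max (n - m) m` levels. -/
theorem receive_eq_of_window_eq {n m : ℕ} {x x' z z' : Signal (max n m)}
    (hs : shift (max n m - m) x = shift (max n m - m) x')
    (hw : window (max n m - max (n - m) m) (max (n - m) m) (receive n m x z) =
      window (max n m - max (n - m) m) (max (n - m) m) (receive n m x' z')) :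
    receive n m x z = receive n m x' z' := by
  rw [shift_eq_shift_iff (le_max_right n m)] at hs
  funext i
  by_cases hi : max n m - max (n - m) m ≤ (i : ℕ)
  · exact apply_eq_of_window_eq hw i hi (by omega)
  · have h1 : ¬ (max n m - m ≤ (i : ℕ)) := by omega
    simp only [receive, shift, Pi.add_apply, h1, if_false]
    split_ifs with h2
    · rw [hs _ (by simp only; omega)]
    · rfl

theorem card_signals (N t : ℕ) : Fintype.card (Fin N → Signal t) = 2 ^ (t * N) := by
  simp [ZMod.card, pow_mul]

/-! ### Converse: counting the pairs that are decoded correctly -/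

namespace Code

variable {n m N : ℕ} {M₁ M₂ : Type} (c : Code n m N M₁ M₂)

theorem out₁_eq (w₁ : M₁) (w₂ : M₂) (j : Fin N) :
    c.out₁ w₁ w₂ j = receive n m (c.in₁ w₁ w₂ j) (c.enc₂ j w₂) := by
  rw [out₁, in₁]

theorem in₁_eq_of_out₁_eq {w₁ : M₁} {w₂ w₂' : M₂} (h : c.out₁ w₁ w₂ = c.out₁ w₁ w₂')
    (j : Fin N) : c.in₁ w₁ w₂ j = c.in₁ w₁ w₂' j := by
  simp only [in₁, h]

/-- Message 1 and the output of receiver 1 determine the interference caused by transmitter 2. -/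
theorem shift_enc₂_eq_of_out₁_eq {w₁ : M₁} {w₂ w₂' : M₂} (h : c.out₁ w₁ w₂ = c.out₁ w₁ w₂')
    (j : Fin N) :
    shift (max n m - m) (c.enc₂ j w₂) = shift (max n m - m) (c.enc₂ j w₂') := by
  have hj := congrFun h j
  rw [out₁_eq, out₁_eq, c.in₁_eq_of_out₁_eq h j] at hj
  exact add_left_cancel hj

/-- Message 2 and the output of receiver 2 determine the interference caused by transmitter 1. -/
theorem shift_in₁_eq_of_out₂_eq {w₁ w₁' : M₁} {w₂ : M₂} (h : c.out₂ w₁ w₂ = c.out₂ w₁' w₂)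
    (j : Fin N) :
    shift (max n m - m) (c.in₁ w₁ w₂ j) = shift (max n m - m) (c.in₁ w₁' w₂ j) :=
  add_left_cancel (congrFun h j)

theorem out₁_eq_of_shift_in₁_eq {w₁ w₁' : M₁} {w₂ : M₂}
    (h : ∀ j, shift (max n m - n) (c.in₁ w₁ w₂ j) = shift (max n m - n) (c.in₁ w₁' w₂ j)) :
    c.out₁ w₁ w₂ = c.out₁ w₁' w₂ := by
  funext j
  rw [out₁_eq, out₁_eq, receive, receive, h j]

/-- Both receivers decode this message pair correctly. -/
def Good (w : M₁ × M₂) : Prop :=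
  c.dec₁ (c.out₁ w.1 w.2) = w.1 ∧ c.dec₂ (c.out₂ w.1 w.2) = w.2

variable {c}

theorem Good.fst_eq {w w' : M₁ × M₂} (h : c.Good w) (h' : c.Good w')
    (ho : c.out₁ w.1 w.2 = c.out₁ w'.1 w'.2) : w.1 = w'.1 := by
  rw [← h.1, ← h'.1, ho]

theorem Good.snd_eq {w w' : M₁ × M₂} (h : c.Good w) (h' : c.Good w')
    (ho : c.out₂ w.1 w.2 = c.out₂ w'.1 w'.2) : w.2 = w'.2 := by
  rw [← h.2, ← h'.2, ho]

/-- For one value of message 2, the output of receiver 1 depends on the top `n` levels sent by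
transmitter 1 only. -/
theorem card_le_of_good_fst (s : Finset M₁) (w₂ : M₂) (hs : ∀ w₁ ∈ s, c.Good (w₁, w₂)) :
    s.card ≤ 2 ^ (n * N) := by
  classical
  rw [← card_signals, ← Finset.card_univ]
  refine Finset.card_le_card_of_injOn (fun w₁ j => window 0 n (c.in₁ w₁ w₂ j))
    (fun _ _ => Finset.mem_coe.2 (Finset.mem_univ _)) ?_
  intro w₁ h w₁' h' he
  refine (hs w₁ h).fst_eq (hs w₁' h') (c.out₁_eq_of_shift_in₁_eq fun j => ?_)
  rw [shift_eq_shift_iff (le_max_left n m)]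
  exact fun i hi => apply_eq_of_window_eq (congrFun he j) i (Nat.zero_le _) (by omega)

theorem card_le_of_good_snd (s : Finset M₂) (hs : ∀ w₂ ∈ s, ∃ w₁, c.Good (w₁, w₂)) :
    s.card ≤ 2 ^ (max n m * N) := by
  classical
  rcases s.eq_empty_or_nonempty with rfl | ⟨w, hw⟩
  · simp
  have : Nonempty M₁ := ⟨(hs w hw).choose⟩
  choose! f hf using hs
  rw [← card_signals, ← Finset.card_univ]
  refine Finset.card_le_card_of_injOn (fun w₂ => c.out₂ (f w₂) w₂)
    (fun _ _ => Finset.mem_coe.2 (Finset.mem_univ _)) ?_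
  exact fun w₂ h w₂' h' he => (hf w₂ h).snd_eq (hf w₂' h') he

/-- The output of receiver 1 yields message 1, hence the top `m` levels sent by transmitter 2;
the other levels that receiver 2 can see are the `n - m` levels below them. -/
theorem card_le_of_good (s : Finset (M₁ × M₂)) (hs : ∀ w ∈ s, c.Good w) :
    s.card ≤ 2 ^ ((n - m + max n m) * N) := by
  classical
  have hcard : Fintype.card ((Fin N → Signal (max n m)) × (Fin N → Signal (n - m))) =
      2 ^ ((n - m + max n m) * N) := by
    rw [Fintype.card_prod, card_signals, card_signals, ← pow_add]; congr 1; ring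
  rw [← hcard, ← Finset.card_univ]
  refine Finset.card_le_card_of_injOn
    (fun w => (c.out₁ w.1 w.2, fun j => window m (n - m) (c.enc₂ j w.2)))
    (fun _ _ => Finset.mem_coe.2 (Finset.mem_univ _)) ?_
  rintro ⟨w₁, w₂⟩ h ⟨w₁', w₂'⟩ h' he
  obtain ⟨ho, hw⟩ := Prod.mk.inj he
  obtain rfl : w₁ = w₁' := (hs _ h).fst_eq (hs _ h') ho
  refine Prod.ext rfl ((hs _ h).snd_eq (hs _ h') ?_)
  funext j
  simp only [out₂, receive, c.in₁_eq_of_out₁_eq ho j]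
  rw [shift_eq_of_shift_eq_of_window_eq (c.shift_enc₂_eq_of_out₁_eq ho j) (congrFun hw j)]

/-- The interference at receiver 1 during the whole transmission. -/
def interference (c : Code n m N M₁ M₂) (w₂ : M₂) : Fin N → Signal (max n m) :=
  fun j => shift (max n m - m) (c.enc₂ j w₂)

/-- Receiver 1 learns message 1 and the interference, so that both together are limited by the
number of its outputs. -/
theorem card_le_of_injOn_interference (s : Finset (M₁ × M₂)) (hs : ∀ w ∈ s, c.Good w)
    (hi : Set.InjOn c.interference {w₂ | ∃ w₁, (w₁, w₂) ∈ s}) :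
    s.card ≤ 2 ^ (max n m * N) := by
  classical
  rw [← card_signals, ← Finset.card_univ]
  refine Finset.card_le_card_of_injOn (fun w => c.out₁ w.1 w.2)
    (fun _ _ => Finset.mem_coe.2 (Finset.mem_univ _)) ?_
  rintro ⟨w₁, w₂⟩ h ⟨w₁', w₂'⟩ h' he
  obtain rfl : w₁ = w₁' := (hs _ h).fst_eq (hs _ h') he
  exact Prod.ext rfl (hi ⟨_, h⟩ ⟨_, h'⟩ (funext fun j => c.shift_enc₂_eq_of_out₁_eq he j))

/-- Given the interference at receiver 1, the lowest `max (n - m) m` levels of the output of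
receiver 2 yield message 2 and then the interference at receiver 2; with the `n - m` levels of
input 1 that receiver 2 does not see, this determines what receiver 1 sees, hence message 1. -/
theorem card_le_of_interference_mem (s : Finset (M₁ × M₂)) (hs : ∀ w ∈ s, c.Good w)
    (t : Finset (Fin N → Signal (max n m))) (ht : ∀ w ∈ s, c.interference w.2 ∈ t) :
    s.card ≤ t.card * 2 ^ ((n - m + max (n - m) m) * N) := by
  classical
  have hcard : (t ×ˢ (Finset.univ :
      Finset ((Fin N → Signal (max (n - m) m)) × (Fin N → Signal (n - m))))).card =
      t.card * 2 ^ ((n - m + max (n - m) m) * N) := by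
    rw [Finset.card_product, Finset.card_univ, Fintype.card_prod, card_signals, card_signals,
      ← pow_add]
    congr 2; ring
  rw [← hcard]
  refine Finset.card_le_card_of_injOn
    (fun w => (c.interference w.2,
      (fun j => window (max n m - max (n - m) m) (max (n - m) m) (c.out₂ w.1 w.2 j)),
      fun j => window m (n - m) (c.in₁ w.1 w.2 j)))
    (fun w hw => Finset.mem_coe.2 (Finset.mem_product.2 ⟨ht w hw, Finset.mem_univ _⟩)) ?_
  rintro ⟨w₁, w₂⟩ h ⟨w₁', w₂'⟩ h' he
  obtain ⟨hv, he'⟩ := Prod.mk.inj he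
  obtain ⟨hy, hx⟩ := Prod.mk.inj he'
  have ho : c.out₂ w₁ w₂ = c.out₂ w₁' w₂' :=
    funext fun j => receive_eq_of_window_eq (congrFun hv j) (congrFun hy j)
  obtain rfl : w₂ = w₂' := (hs _ h).snd_eq (hs _ h') ho
  refine Prod.ext ((hs _ h).fst_eq (hs _ h') ?_) rfl
  exact c.out₁_eq_of_shift_in₁_eq fun j =>
    shift_eq_of_shift_eq_of_window_eq (c.shift_in₁_eq_of_out₂_eq ho j) (congrFun hx j)

/-- With error probabilities at most `1 / 8`, at least three quarters of the message pairs are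
decoded correctly by both receivers. -/
theorem card_good_ge [Fintype M₁] [Fintype M₂] [Nonempty M₁] [Nonempty M₂]
    [DecidablePred c.Good]
    (h₁ : c.errProb₁ ≤ 1 / 8) (h₂ : c.errProb₂ ≤ 1 / 8) :
    3 * (Fintype.card M₁ * Fintype.card M₂) ≤
      4 * (Finset.univ.filter c.Good).card := by
  classical
  have hpos : (0 : ℝ) < Nat.card (M₁ × M₂) := by exact_mod_cast Nat.card_pos
  rw [errProb₁, div_le_iff₀ hpos, Nat.card_eq_fintype_card, Nat.card_eq_fintype_card,
    Fintype.card_subtype] at h₁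
  rw [errProb₂, div_le_iff₀ hpos, Nat.card_eq_fintype_card, Nat.card_eq_fintype_card,
    Fintype.card_subtype] at h₂
  have hle : Fintype.card (M₁ × M₂) ≤ (Finset.univ.filter c.Good).card +
      ((Finset.univ.filter fun w : M₁ × M₂ => c.dec₁ (c.out₁ w.1 w.2) ≠ w.1).card +
        (Finset.univ.filter fun w : M₁ × M₂ => c.dec₂ (c.out₂ w.1 w.2) ≠ w.2).card) := by
    rw [← Finset.card_univ]
    refine le_trans (Finset.card_le_card ?_)
      ((Finset.card_union_le _ _).trans (Nat.add_le_add_left (Finset.card_union_le _ _) _))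
    intro w _
    simp only [Finset.mem_union, Finset.mem_filter, Finset.mem_univ, true_and, Good]
    tauto
  rw [← Fintype.card_prod]
  have hle' : (Fintype.card (M₁ × M₂) : ℝ) ≤ (Finset.univ.filter c.Good).card +
      ((Finset.univ.filter fun w : M₁ × M₂ => c.dec₁ (c.out₁ w.1 w.2) ≠ w.1).card +
        (Finset.univ.filter fun w : M₁ × M₂ => c.dec₂ (c.out₂ w.1 w.2) ≠ w.2).card) := by
    exact_mod_cast hle
  have : (3 * Fintype.card (M₁ × M₂) : ℝ) ≤ 4 * (Finset.univ.filter c.Good).card := by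
    linarith
  exact_mod_cast this

theorem card_bounds [Fintype M₁] [Fintype M₂] [Nonempty M₁] [Nonempty M₂]
    (h₁ : c.errProb₁ ≤ 1 / 8) (h₂ : c.errProb₂ ≤ 1 / 8) :
    Fintype.card M₁ ≤ 2 * 2 ^ (n * N) ∧
    Fintype.card M₂ ≤ 4 * 2 ^ (max n m * N) ∧
    Fintype.card M₁ * Fintype.card M₂ ≤ 2 * 2 ^ ((n - m + max n m) * N) ∧
    Fintype.card M₁ ^ 2 * Fintype.card M₂ ≤
      16 * 2 ^ ((n - m + max n m + max (n - m) m) * N) := by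
  classical
  have hG := card_good_ge h₁ h₂
  set A := Fintype.card M₁
  set B := Fintype.card M₂
  set G : Finset (M₁ × M₂) := Finset.univ.filter c.Good
  have hGood : ∀ w ∈ G, c.Good w := fun w hw => (Finset.mem_filter.1 hw).2
  -- `F w₂` consists of the messages 1 that are decoded together with `w₂`, and `T` of those
  -- messages 2 for which `F w₂` contains at least half of the messages 1.
  let F : M₂ → Finset M₁ := fun w₂ => Finset.univ.filter fun w₁ => c.Good (w₁, w₂)
  let T : Finset M₂ := Finset.univ.filter fun w₂ => A ≤ 2 * (F w₂).card
  have hFG : ∀ s : Finset M₂, (G.filter fun w => w.2 ∈ s).card = ∑ w₂ ∈ s, (F w₂).card := by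
    intro s
    have hmaps : Set.MapsTo Prod.snd (G.filter fun w => w.2 ∈ s : Set (M₁ × M₂)) s :=
      fun w hw => (Finset.mem_filter.1 (Finset.mem_coe.1 hw)).2
    rw [Finset.card_eq_sum_card_fiberwise hmaps]
    refine Finset.sum_congr rfl fun w₂ hw₂ => ?_
    refine Finset.card_bij' (fun w _ => w.1) (fun w₁ _ => (w₁, w₂)) ?_ ?_ ?_ ?_
    · rintro ⟨w₁, w₂'⟩ hw
      simp only [Finset.mem_filter, G, Finset.mem_univ, true_and, F] at hw ⊢
      obtain ⟨⟨hw, -⟩, rfl⟩ := hw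
      exact hw
    · intro w₁ hw
      simp only [Finset.mem_filter, G, Finset.mem_univ, true_and, F] at hw ⊢
      exact ⟨⟨hw, hw₂⟩, trivial⟩
    · rintro ⟨w₁, w₂'⟩ hw
      simp only [Finset.mem_filter] at hw
      rw [← hw.2]
    · intro w₁ _
      rfl
  have hApos : 0 < A := Fintype.card_pos
  have hBpos : 0 < B := Fintype.card_pos
  have hFle : ∀ w₂, (F w₂).card ≤ A := fun w₂ => Finset.card_le_univ _
  have hTB : B ≤ 4 * T.card := by
    have hsum : G.card = ∑ w₂, (F w₂).card := by
      rw [← hFG Finset.univ]; simp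
    have hle : 2 * G.card ≤ ∑ w₂ : M₂, (A + if w₂ ∈ T then A else 0) := by
      rw [hsum, Finset.mul_sum]
      refine Finset.sum_le_sum fun w₂ _ => ?_
      split_ifs with h
      · have := hFle w₂; omega
      · simp only [T, Finset.mem_filter, Finset.mem_univ, true_and] at h; omega
    rw [Finset.sum_add_distrib, Finset.sum_const, Finset.card_univ, ← Finset.sum_filter,
      Finset.sum_const, smul_eq_mul, smul_eq_mul] at hle
    have hTT : (Finset.univ.filter fun w₂ => w₂ ∈ T) = T := by simp
    rw [hTT] at hle
    change 2 * G.card ≤ B * A + T.card * A at hle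
    have : A * B ≤ A * (2 * T.card) := by nlinarith
    have := Nat.le_of_mul_le_mul_left this hApos
    omega
  have hhalf : ∀ s ⊆ T, s.card * A ≤ 2 * (G.filter fun w => w.2 ∈ s).card := by
    intro s hs
    rw [hFG, Finset.mul_sum, ← smul_eq_mul, ← Finset.sum_const]
    exact Finset.sum_le_sum fun w₂ hw₂ => (Finset.mem_filter.1 (hs hw₂)).2
  have hFpos : ∀ w₂ ∈ T, ∃ w₁, c.Good (w₁, w₂) := by
    intro w₂ hw₂
    have h2 := (Finset.mem_filter.1 hw₂).2
    obtain ⟨w₁, hw₁⟩ := Finset.card_pos.1 (show 0 < (F w₂).card by omega)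
    exact ⟨w₁, (Finset.mem_filter.1 hw₁).2⟩
  refine ⟨?_, ?_, ?_, ?_⟩
  · obtain ⟨w₂, hw₂⟩ := Finset.card_pos.1 (show 0 < T.card by omega)
    have h2 := (Finset.mem_filter.1 hw₂).2
    have := card_le_of_good_fst (F w₂) w₂ fun w₁ hw₁ => (Finset.mem_filter.1 hw₁).2
    omega
  · have := card_le_of_good_snd T hFpos
    omega
  · have := card_le_of_good G hGood
    omega
  · -- `U` contains one message of `T` for each interference that messages in `T` cause.
    obtain ⟨U, hUT, himg, hinj⟩ : ∃ U ⊆ T, U.image c.interference = T.image c.interference ∧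
        Set.InjOn c.interference U := by
      obtain ⟨U, hU, hbij⟩ := Set.SurjOn.exists_bijOn_subset
        (s := (T : Set M₂)) (t := c.interference '' T) (f := c.interference)
        (Set.surjOn_image _ _)
      refine ⟨U.toFinite.toFinset, ?_, ?_, ?_⟩
      · intro x hx
        exact hU ((Set.Finite.mem_toFinset _).1 hx)
      · apply Finset.coe_injective
        simp [hbij.image_eq]
      · simpa using hbij.injOn
    have h1 := card_le_of_injOn_interference (c := c) (G.filter fun w => w.2 ∈ U)
      (fun w hw => hGood w (Finset.mem_filter.1 hw).1)
      (hinj.mono fun w₂ ⟨w₁, hw⟩ => (Finset.mem_filter.1 hw).2)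
    have h2 := card_le_of_interference_mem (c := c) (G.filter fun w => w.2 ∈ T)
      (fun w hw => hGood w (Finset.mem_filter.1 hw).1) (U.image c.interference)
      (fun w hw => himg ▸ Finset.mem_image_of_mem _ (Finset.mem_filter.1 hw).2)
    rw [Finset.card_image_of_injOn hinj] at h2
    have h3 := hhalf U hUT
    have h4 := hhalf T subset_rfl
    set P := 2 ^ (max n m * N)
    set Q := 2 ^ ((n - m + max (n - m) m) * N)
    have hPQ : 2 ^ ((n - m + max n m + max (n - m) m) * N) = P * Q := by
      rw [← pow_add]; congr 1; ring
    rw [hPQ]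
    calc A ^ 2 * B ≤ A ^ 2 * (4 * T.card) := Nat.mul_le_mul_left _ hTB
      _ = 4 * A * (T.card * A) := by ring
      _ ≤ 4 * A * (2 * (U.card * Q)) :=
        Nat.mul_le_mul_left _ (h4.trans (Nat.mul_le_mul_left _ h2))
      _ = 8 * (U.card * A) * Q := by ring
      _ ≤ 8 * (2 * P) * Q :=
        Nat.mul_le_mul_right _ (Nat.mul_le_mul_left _ (h3.trans (Nat.mul_le_mul_left _ h1)))
      _ = 16 * (P * Q) := by ring

end Code

/-- Only bounded factors are lost in the passage from exact counts to rates. -/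
theorem le_of_eventually_two_rpow_le {x y C : ℝ}
    (h : ∀ᶠ N : ℕ in Filter.atTop, (2 : ℝ) ^ ((N : ℝ) * x) ≤ 2 ^ C * 2 ^ ((N : ℝ) * y)) :
    x ≤ y := by
  by_contra! hlt
  obtain ⟨K, hK⟩ := exists_nat_gt (C / (x - y))
  obtain ⟨N, hN, hNK⟩ := (h.and (Filter.eventually_ge_atTop K)).exists
  rw [← Real.rpow_add two_pos, Real.rpow_le_rpow_left_iff one_lt_two] at hN
  have hNK' : (K : ℝ) ≤ N := by exact_mod_cast hNK
  rw [div_lt_iff₀ (sub_pos.2 hlt)] at hK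
  nlinarith [mul_le_mul_of_nonneg_right hNK' (sub_pos.2 hlt).le]

theorem one_le_floor_message (N : ℕ) {R : ℝ} (hR : 0 ≤ R) :
    1 ≤ ⌊(2 : ℝ) ^ ((N : ℝ) * R)⌋₊ := by
  rw [Nat.one_le_floor_iff]
  exact Real.one_le_rpow one_le_two (by positivity)

theorem two_rpow_le_card_message (N : ℕ) {R : ℝ} (hR : 0 ≤ R) :
    (2 : ℝ) ^ ((N : ℝ) * R) ≤ 2 * (Fintype.card (Message N R) : ℝ) := by
  have h1 : (1 : ℝ) ≤ ⌊(2 : ℝ) ^ ((N : ℝ) * R)⌋₊ := by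
    exact_mod_cast one_le_floor_message N hR
  have h2 := (Nat.lt_floor_add_one ((2 : ℝ) ^ ((N : ℝ) * R))).le
  rw [Fintype.card_fin]
  linarith

/-- The polygon in the quadrant `0 ≤ x`, `0 ≤ y` cut out by bounds on `x`, `y`, `x + y` and
`2 x + y`. -/
def polygon (A B C D : ℝ) : Set (ℝ × ℝ) :=
  {R | 0 ≤ R.1 ∧ 0 ≤ R.2 ∧ R.1 ≤ A ∧ R.2 ≤ B ∧ R.1 + R.2 ≤ C ∧ 2 * R.1 + R.2 ≤ D}

/-- The polygon of the capacity theorem. -/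
def region (n m : ℕ) : Set (ℝ × ℝ) :=
  polygon n (max (n : ℝ) m) (max ((n : ℝ) - m) 0 + max (n : ℝ) m)
    (max ((n : ℝ) - m) 0 + max (n : ℝ) m + max ((n : ℝ) - m) m)

theorem cast_tsub_max (n m : ℕ) : ((n - m : ℕ) : ℝ) = max ((n : ℝ) - m) 0 := by
  rcases le_total m n with h | h
  · rw [Nat.cast_sub h, max_eq_left (sub_nonneg.2 (by exact_mod_cast h))]
  · rw [Nat.sub_eq_zero_of_le h, Nat.cast_zero,
      max_eq_right (sub_nonpos.2 (by exact_mod_cast h))]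

theorem cast_max_tsub (n m : ℕ) : ((max (n - m) m : ℕ) : ℝ) = max ((n : ℝ) - m) m := by
  rw [Nat.cast_max, cast_tsub_max, max_assoc, max_eq_right (Nat.cast_nonneg m)]

theorem mem_region_of_achievable {n m : ℕ} {R : ℝ × ℝ} (h : Achievable n m R) :
    R ∈ region n m := by
  obtain ⟨h1, h2, c, hc⟩ := h
  have hev : ∀ᶠ N : ℕ in Filter.atTop, max (c N).errProb₁ (c N).errProb₂ ≤ 1 / 8 :=
    (hc.eventually (eventually_lt_nhds (by norm_num : (0 : ℝ) < 1 / 8))).mono fun _ h => h.le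
  have key : ∀ᶠ N : ℕ in Filter.atTop,
      (2 : ℝ) ^ ((N : ℝ) * R.1) ≤ 4 * 2 ^ ((N : ℝ) * (n : ℝ)) ∧
      (2 : ℝ) ^ ((N : ℝ) * R.2) ≤ 8 * 2 ^ ((N : ℝ) * ((max n m : ℕ) : ℝ)) ∧
      (2 : ℝ) ^ ((N : ℝ) * (R.1 + R.2)) ≤
        8 * 2 ^ ((N : ℝ) * ((n - m + max n m : ℕ) : ℝ)) ∧
      (2 : ℝ) ^ ((N : ℝ) * (2 * R.1 + R.2)) ≤
        128 * 2 ^ ((N : ℝ) * ((n - m + max n m + max (n - m) m : ℕ) : ℝ)) := by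
    filter_upwards [hev] with N hN
    have : Nonempty (Message N R.1) := ⟨⟨0, one_le_floor_message N h1⟩⟩
    have : Nonempty (Message N R.2) := ⟨⟨0, one_le_floor_message N h2⟩⟩
    obtain ⟨b1, b2, b3, b4⟩ := Code.card_bounds ((le_max_left _ _).trans hN)
      ((le_max_right _ _).trans hN)
    have e1 := two_rpow_le_card_message N h1
    have e2 := two_rpow_le_card_message N h2
    have hp : ∀ k : ℕ, ((2 : ℝ)) ^ ((N : ℝ) * (k : ℝ)) = ((2 ^ (k * N) : ℕ) : ℝ) := by
      intro k
      rw [mul_comm, ← Nat.cast_mul, Real.rpow_natCast]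
      push_cast; rfl
    set A := Fintype.card (Message N R.1)
    set B := Fintype.card (Message N R.2)
    have p1 : 0 < (2 : ℝ) ^ ((N : ℝ) * R.1) := by positivity
    have p2 : 0 < (2 : ℝ) ^ ((N : ℝ) * R.2) := by positivity
    rw [hp, hp, hp, hp]
    have b1' : (A : ℝ) ≤ 2 * ((2 ^ (n * N) : ℕ) : ℝ) := by exact_mod_cast b1
    have b2' : (B : ℝ) ≤ 4 * ((2 ^ (max n m * N) : ℕ) : ℝ) := by exact_mod_cast b2
    have b3' : (A : ℝ) * B ≤ 2 * ((2 ^ ((n - m + max n m) * N) : ℕ) : ℝ) := by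
      exact_mod_cast b3
    have b4' : (A : ℝ) ^ 2 * B ≤
        16 * ((2 ^ ((n - m + max n m + max (n - m) m) * N) : ℕ) : ℝ) := by
      exact_mod_cast b4
    refine ⟨by linarith, by linarith, ?_, ?_⟩
    · rw [mul_add, Real.rpow_add two_pos]
      calc _ ≤ (2 * (A : ℝ)) * (2 * B) := by gcongr
        _ = 4 * (A * B) := by ring
        _ ≤ _ := by linarith
    · rw [show (N : ℝ) * (2 * R.1 + R.2) = N * R.1 + N * R.1 + N * R.2 by ring,
        Real.rpow_add two_pos, Real.rpow_add two_pos]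
      calc _ ≤ (2 * (A : ℝ)) * (2 * A) * (2 * B) := by gcongr
        _ = 8 * (A ^ 2 * B) := by ring
        _ ≤ _ := by linarith
  have c4 : (4 : ℝ) = 2 ^ (2 : ℝ) := by norm_num
  have c8 : (8 : ℝ) = 2 ^ (3 : ℝ) := by norm_num
  have c128 : (128 : ℝ) = 2 ^ (7 : ℝ) := by norm_num
  have r1 := le_of_eventually_two_rpow_le (key.mono fun N h => c4 ▸ h.1)
  have r2 := le_of_eventually_two_rpow_le (key.mono fun N h => c8 ▸ h.2.1)
  have r3 := le_of_eventually_two_rpow_le (key.mono fun N h => c8 ▸ h.2.2.1)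
  have r4 := le_of_eventually_two_rpow_le (key.mono fun N h => c128 ▸ h.2.2.2)
  rw [Nat.cast_max] at r2
  rw [Nat.cast_add, Nat.cast_max, cast_tsub_max] at r3
  rw [Nat.cast_add, Nat.cast_add, cast_max_tsub, Nat.cast_max, cast_tsub_max] at r4
  exact ⟨h1, h2, r1, r2, r3, r4⟩

theorem isClosed_polygon (A B C D : ℝ) : IsClosed (polygon A B C D) := by
  have c1 : Continuous fun R : ℝ × ℝ => R.1 := continuous_fst
  have c2 : Continuous fun R : ℝ × ℝ => R.2 := continuous_snd
  exact (isClosed_le continuous_const c1).inter <| (isClosed_le continuous_const c2).inter <|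
    (isClosed_le c1 continuous_const).inter <| (isClosed_le c2 continuous_const).inter <|
    (isClosed_le (c1.add c2) continuous_const).inter <|
    isClosed_le ((continuous_const.mul c1).add c2) continuous_const

theorem capacityRegion_subset_region (n m : ℕ) : capacityRegion n m ⊆ region n m :=
  closure_minimal (fun _ h => mem_region_of_achievable h) (isClosed_polygon _ _ _ _)

/-! ### Error-freeness of relay schemes -/

section Run

variable {q r N : ℕ} {O : Type} {step : Signal q → Signal r → O × Signal r}
  {y : Fin N → Signal q} {o : Fin N → O} {ρ : ℕ → Signal r}

theorem runState_eq (h0 : ρ 0 = 0) (h : ∀ i : Fin N, step (y i) (ρ i) = (o i, ρ (i + 1))) :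
    ∀ (i : ℕ) (hi : i ≤ N), runState step y i hi = ρ i
  | 0, _ => h0.symm
  | i + 1, hi => by
    rw [runState, runState_eq h0 h i (Nat.le_of_succ_le hi), h ⟨i, hi⟩]

theorem run_forward_eq (h0 : ρ 0 = 0) (h : ∀ i : Fin N, step (y i) (ρ i) = (o i, ρ (i + 1)))
    (i : Fin N) : run step .forward y i = o i := by
  rw [run, runState_eq h0 h, h]

/-- A backward receiver meets the same states as a forward one, in the opposite order. -/
theorem run_backward_eq (hN : ρ N = 0)
    (h : ∀ i : Fin N, step (y i) (ρ (i + 1)) = (o i, ρ i)) (i : Fin N) :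
    run step .backward y i = o i := by
  have hs : ∀ i : Fin N, step (y i.rev) (ρ (N - i)) = (o i.rev, ρ (N - (i + 1))) := by
    intro i
    have := h i.rev
    rw [Fin.val_rev, show N - ((i : ℕ) + 1) + 1 = N - i by omega] at this
    exact this
  rw [run, runState_eq (y := fun j => y j.rev) (o := fun j => o j.rev) (ρ := fun j => ρ (N - j))
    (by simpa using hN) hs, Fin.val_rev, show N - (N - ((i : ℕ) + 1)) = i + 1 by omega, h]

end Run

namespace RelayScheme

theorem fill_add {ι : Type} {q : ℕ} (l : Fin q → Option ι) (b b' : ι → ZMod 2) :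
    fill l (b + b') = fill l b + fill l b' := by
  funext i
  cases h : l i <;> simp [fill, h]

theorem fill_of_eq_some {ι : Type} {q : ℕ} {l : Fin q → Option ι} (b : ι → ZMod 2) {i : Fin q}
    {s : ι} (h : l i = some s) : fill l b i = b s := by
  simp [fill, h]

theorem fill_of_eq_none {ι : Type} {q : ℕ} {l : Fin q → Option ι} (b : ι → ZMod 2) {i : Fin q}
    (h : l i = none) : fill l b i = 0 := by
  simp [fill, h]

end RelayScheme

theorem receive_add {n m : ℕ} (x x' z z' : Signal (max n m)) :
    receive n m (x + x') (z + z') = receive n m x z + receive n m x' z' := by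
  simp only [receive, shift_add]
  abel

/-- The bits sent in one block: fresh bits of transmitter 1, relayed bits, and the bits of
transmitter 2. -/
abbrev BlockBits (k₁ k₂ r : ℕ) : Type := Signal k₁ × Signal r × (Fin k₂ ⊕ Fin r → ZMod 2)

section Layout

variable {n m k₁ k₂ r : ℕ} (l₁ : Fin (max n m) → Option (Fin k₁ ⊕ Fin r))
  (l₂ : Fin (max n m) → Option (Fin k₂ ⊕ Fin r))

/-- Output of receiver 1 in a block, as a function of the bits sent. -/
def blockOut₁ : BlockBits k₁ k₂ r →+ Signal (max n m) :=
  AddMonoidHom.mk' (fun x => receive n m (RelayScheme.fill l₁ (Sum.elim x.1 x.2.1))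
    (RelayScheme.fill l₂ x.2.2)) fun x x' => by
      rw [← receive_add, ← RelayScheme.fill_add, ← RelayScheme.fill_add]
      congr 2
      funext s
      cases s <;> rfl

/-- Output of receiver 2 in a block, as a function of the bits sent. -/
def blockOut₂ : BlockBits k₁ k₂ r →+ Signal (max n m) :=
  AddMonoidHom.mk' (fun x => receive n m (RelayScheme.fill l₂ x.2.2)
    (RelayScheme.fill l₁ (Sum.elim x.1 x.2.1))) fun x x' => by
      rw [← receive_add, ← RelayScheme.fill_add, ← RelayScheme.fill_add]
      congr 2
      funext s
      cases s <;> rfl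

/-- The relay bits that a receiver working in the given direction knows before it processes a
block: those of the preceding block, or those of the block itself, which it has seen relayed in
the following block. -/
def known : Direction → BlockBits k₁ k₂ r →+ Signal r
  | .forward => AddMonoidHom.mk' (fun x => x.2.1) fun _ _ => rfl
  | .backward => AddMonoidHom.mk' (fun x t => x.2.2 (Sum.inr t)) fun _ _ => rfl

/-- The relay bits that a receiver working in the given direction learns from a block. -/
def learnt : Direction → BlockBits k₁ k₂ r →+ Signal r
  | .forward => known .backward
  | .backward => known .forward

end Layout

/-- A homomorphism factors through another one, as a function, if the kernels allow it. -/
theorem exists_factor {A B C : Type} [AddGroup A] [AddGroup B] [AddGroup C] (f : A →+ B)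
    (g : A →+ C) (h : ∀ x, f x = 0 → g x = 0) : ∃ e : B → C, ∀ x, e (f x) = g x := by
  have hfac : Function.FactorsThrough g f := by
    intro x y hxy
    rw [← sub_eq_zero, ← map_sub]
    exact h _ (by rw [map_sub, hxy, sub_self])
  obtain ⟨e, he⟩ := (Function.factorsThrough_iff _).1 hfac
  exact ⟨e, fun x => (congrFun he x).symm⟩

theorem delayedBlock_succ {ι : Type} {L : ℕ} (w : Fin L → ι → ZMod 2) (i : Fin L) :
    delayedBlock w (i + 1) = w i := by
  simp [delayedBlock, block]

namespace RelayScheme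

variable {n m : ℕ}

/-- The relay bits of the block before block `j`. -/
def relayBits {k₂ r L : ℕ} (w₂ : Fin L → Fin k₂ ⊕ Fin r → ZMod 2) (j : ℕ) : Signal r :=
  fun t => delayedBlock w₂ j (Sum.inr t)

/-- The bits sent in block `j`. -/
def bits {k₁ k₂ r L : ℕ} (w₁ : Fin L → Signal k₁) (w₂ : Fin L → Fin k₂ ⊕ Fin r → ZMod 2)
    (j : ℕ) : BlockBits k₁ k₂ r :=
  (delayedBlock w₁ j, relayBits w₂ j, block w₂ j)

/-- The extraction and decoding maps of the scheme work in every block, whatever the bits. -/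
structure Resolves (S : RelayScheme n m) : Prop where
  extract : ∀ x : BlockBits S.k₁ S.k₂ S.r,
    S.extract (blockOut₁ S.layout₁ S.layout₂ x) x.1 x.2.1 = known .backward x
  step₁ : ∀ x : BlockBits S.k₁ S.k₂ S.r,
    S.step₁ (blockOut₁ S.layout₁ S.layout₂ x) (known S.dir₁ x) = (x.1, learnt S.dir₁ x)
  step₂ : ∀ x : BlockBits S.k₁ S.k₂ S.r,
    S.step₂ (blockOut₂ S.layout₁ S.layout₂ x) (known S.dir₂ x) = (x.2.2, learnt S.dir₂ x)

theorem run_eq {k₁ k₂ r L q : ℕ} {O : Type} {step : Signal q → Signal r → O × Signal r}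
    {d : Direction} {y : Fin (L + 1) → Signal q} {o : Fin (L + 1) → O}
    (w₁ : Fin L → Signal k₁) (w₂ : Fin L → Fin k₂ ⊕ Fin r → ZMod 2)
    (h : ∀ j : Fin (L + 1), step (y j) (known d (bits w₁ w₂ j)) =
      (o j, learnt d (bits w₁ w₂ j))) (j : Fin (L + 1)) : run step d y j = o j := by
  cases d with
  | forward => exact run_forward_eq (ρ := relayBits w₂) rfl h j
  | backward =>
    -- The last block is silent at transmitter 2, so the state starts with the right value.
    refine run_backward_eq (ρ := relayBits w₂) ?_ h j
    funext t
    simp [relayBits, delayedBlock, block]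

theorem relayed_eq (S : RelayScheme n m) (hS : S.Resolves) {L : ℕ} (w₁ : Fin L → Signal S.k₁)
    (w₂ : Fin L → Fin S.k₂ ⊕ Fin S.r → ZMod 2) :
    ∀ (j : ℕ) (past : Fin j → Signal (max n m)),
      (∀ i, past i = blockOut₁ S.layout₁ S.layout₂ (bits w₁ w₂ i)) →
      S.relayed (delayedBlock w₁) j past = relayBits w₂ j
  | 0, _, _ => rfl
  | j + 1, past, h => by
    rw [relayed, relayed_eq S hS w₁ w₂ j _ fun i => h i.castSucc, h (Fin.last j)]
    exact hS.extract (bits w₁ w₂ j)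

theorem code_out₁ (S : RelayScheme n m) (hS : S.Resolves) {L : ℕ} (w₁ : Fin L → Signal S.k₁)
    (w₂ : Fin L → Fin S.k₂ ⊕ Fin S.r → ZMod 2) (j : ℕ) (hj : j < L + 1) :
    (S.code L).out₁ w₁ w₂ ⟨j, hj⟩ = blockOut₁ S.layout₁ S.layout₂ (bits w₁ w₂ j) := by
  induction j using Nat.strong_induction_on with
  | _ j ih =>
    rw [Code.out₁]
    simp only [code]
    rw [S.relayed_eq hS w₁ w₂ j]
    · rfl
    · exact fun i => ih i i.isLt _

theorem code_out₂ (S : RelayScheme n m) (hS : S.Resolves) {L : ℕ} (w₁ : Fin L → Signal S.k₁)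
    (w₂ : Fin L → Fin S.k₂ ⊕ Fin S.r → ZMod 2) (j : Fin (L + 1)) :
    (S.code L).out₂ w₁ w₂ j = blockOut₂ S.layout₁ S.layout₂ (bits w₁ w₂ j) := by
  have hin : (S.code L).in₁ w₁ w₂ j =
      fill S.layout₁ (Sum.elim (delayedBlock w₁ j) (relayBits w₂ j)) := by
    rw [Code.in₁, ← S.relayed_eq hS w₁ w₂ j _ fun i => S.code_out₁ hS w₁ w₂ i (by omega)]
    rfl
  rw [Code.out₂, hin]
  rfl

theorem errorFree (S : RelayScheme n m) (hS : S.Resolves) (L : ℕ) : (S.code L).ErrorFree := by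
  intro w₁ w₂
  constructor
  · funext i
    refine (run_eq (o := fun j => delayedBlock w₁ j) w₁ w₂ (fun j => ?_) i.succ).trans ?_
    · rw [S.code_out₁ hS w₁ w₂ j j.isLt]
      exact hS.step₁ (bits w₁ w₂ j)
    · exact delayedBlock_succ w₁ i
  · funext i
    refine (run_eq (o := fun j => block w₂ j) w₁ w₂ (fun j => ?_) i.castSucc).trans ?_
    · rw [S.code_out₂ hS w₁ w₂ j]
      exact hS.step₂ (bits w₁ w₂ j)
    · simp [block]

/-- Layouts and directions extend to a scheme without decoding errors as soon as, in one block,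
the bits to be found vanish whenever the output and the known relay bits do: everything being
linear over `𝔽₂`, they are then functions of these. -/
theorem exists_errorFree {k₁ k₂ r : ℕ} (l₁ : Fin (max n m) → Option (Fin k₁ ⊕ Fin r))
    (l₂ : Fin (max n m) → Option (Fin k₂ ⊕ Fin r)) (d₁ d₂ : Direction)
    (he : ∀ b, shift (max n m - m) (fill l₂ b) = 0 → ∀ t, b (Sum.inr t) = 0)
    (h₁ : ∀ x, blockOut₁ l₁ l₂ x = 0 → known d₁ x = 0 → x.1 = 0 ∧ learnt d₁ x = 0)
    (h₂ : ∀ x, blockOut₂ l₁ l₂ x = 0 → known d₂ x = 0 → x.2.2 = 0 ∧ learnt d₂ x = 0) :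
    ∃ S : RelayScheme n m, S.k₁ = k₁ ∧ S.k₂ + S.r = k₂ + r ∧ ∀ L, (S.code L).ErrorFree := by
  obtain ⟨e, hex⟩ := exists_factor
    ((blockOut₁ l₁ l₂).prod ((AddMonoidHom.fst _ _).prod (known .forward)))
    (known .backward) (by
      rintro ⟨a, ρ, b⟩ h
      obtain ⟨h1, h2⟩ := Prod.mk.inj h
      obtain ⟨h3, h4⟩ := Prod.mk.inj h2
      obtain rfl : a = 0 := h3
      obtain rfl : ρ = 0 := h4
      refine funext (he b ?_)
      have hz : fill l₁ (Sum.elim 0 0) = 0 := by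
        funext i
        rcases hi : l₁ i with _ | (_ | _) <;> simp [fill, hi]
      have hs : shift (max n m - n) (0 : Signal (max n m)) = 0 := by
        funext i
        simp [shift]
      have h1' : receive n m (fill l₁ (Sum.elim 0 0)) (fill l₂ b) = 0 := h1
      rwa [receive, hz, hs, zero_add] at h1')
  obtain ⟨s₁, hs₁⟩ := exists_factor ((blockOut₁ l₁ l₂).prod (known d₁))
    ((AddMonoidHom.fst _ _).prod (learnt d₁)) (by
      intro x h
      obtain ⟨h1, h2⟩ := Prod.mk.inj h
      exact Prod.ext (h₁ x h1 h2).1 (h₁ x h1 h2).2)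
  obtain ⟨s₂, hs₂⟩ := exists_factor ((blockOut₂ l₁ l₂).prod (known d₂))
    (((AddMonoidHom.snd _ _).comp (AddMonoidHom.snd _ _)).prod (learnt d₂)) (by
      intro x h
      obtain ⟨h1, h2⟩ := Prod.mk.inj h
      exact Prod.ext (h₂ x h1 h2).1 (h₂ x h1 h2).2)
  let S : RelayScheme n m :=
    { k₁ := k₁, k₂ := k₂, r := r, layout₁ := l₁, layout₂ := l₂
      extract := fun y a ρ => e (y, a, ρ)
      dir₁ := d₁
      step₁ := fun y s => s₁ (y, s)
      dir₂ := d₂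
      step₂ := fun y s => s₂ (y, s) }
  exact ⟨S, rfl, rfl, S.errorFree ⟨hex, hs₁, hs₂⟩⟩

theorem rates_eq (S : RelayScheme n m) (L : ℕ) : (S.code L).rates =
    (((S.k₁ * L : ℕ) : ℝ) / (L + 1 : ℕ), (((S.k₂ + S.r) * L : ℕ) : ℝ) / (L + 1 : ℕ)) := by
  have hlog : ∀ k : ℕ, Real.logb 2 (((2 : ℕ) ^ k : ℕ) : ℝ) = k := by
    intro k
    rw [Nat.cast_pow, Nat.cast_ofNat, Real.logb_pow, Real.logb_self_eq_one one_lt_two, mul_one]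
  simp only [Code.rates, Nat.card_eq_fintype_card, Fintype.card_fun, Fintype.card_fin,
    Fintype.card_sum, ZMod.card, ← pow_mul, hlog]

theorem tendsto_rates (S : RelayScheme n m) :
    Filter.Tendsto (fun L : ℕ => (S.code L).rates) Filter.atTop
      (nhds ((S.k₁ : ℝ), ((S.k₂ + S.r : ℕ) : ℝ))) := by
  have hr : ∀ L : ℕ, (S.code L).rates =
      ((L : ℝ) / (L + 1) * S.k₁, (L : ℝ) / (L + 1) * ((S.k₂ + S.r : ℕ) : ℝ)) := by
    intro L
    rw [rates_eq]
    push_cast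
    refine Prod.ext ?_ ?_ <;> ring
  simp only [hr]
  have ht := tendsto_natCast_div_add_atTop (1 : ℝ)
  have := (ht.mul_const (S.k₁ : ℝ)).prodMk_nhds (ht.mul_const ((S.k₂ + S.r : ℕ) : ℝ))
  simpa only [one_mul] using this

end RelayScheme

/-! ### Relay schemes for the corner points -/

theorem shift_eq_zero_iff {q p : ℕ} (hp : p ≤ q) {x : Signal q} :
    shift (q - p) x = 0 ↔ ∀ i : Fin q, (i : ℕ) < p → x i = 0 := by
  have h0 : shift (q - p) (0 : Signal q) = 0 := by
    funext i
    simp [shift]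
  rw [← h0, shift_eq_shift_iff hp]
  rfl

theorem own_eq_zero {n m : ℕ} {x z : Signal (max n m)} (h : receive n m x z = 0)
    (hz : ∀ i : Fin (max n m), (i : ℕ) < m → z i = 0) (i : Fin (max n m)) (hi : (i : ℕ) < n) :
    x i = 0 := by
  rw [receive, (shift_eq_zero_iff (le_max_right n m)).2 hz, add_zero,
    shift_eq_zero_iff (le_max_left n m)] at h
  exact h i hi

theorem other_eq_zero {n m : ℕ} {x z : Signal (max n m)} (h : receive n m x z = 0)
    (hx : ∀ i : Fin (max n m), (i : ℕ) < n → x i = 0) (i : Fin (max n m)) (hi : (i : ℕ) < m) :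
    z i = 0 := by
  rw [receive, (shift_eq_zero_iff (le_max_left n m)).2 hx, zero_add,
    shift_eq_zero_iff (le_max_right n m)] at h
  exact h i hi

/-- If the own signal is the stronger one, a level of it is zero where the output vanishes and
the interfering level, if there is one, does. -/
theorem own_level_eq_zero {n m : ℕ} {x z : Signal (max n m)} (h : receive n m x z = 0)
    (hmn : m ≤ n) (i : Fin (max n m))
    (hz : ∀ j : Fin (max n m), (j : ℕ) + (n - m) = i → z j = 0) : x i = 0 := by
  have hi := congrFun h i
  have h0 : max n m - n = 0 := by omega
  simp only [receive, shift, Pi.add_apply, h0, Nat.zero_le, if_true, Nat.sub_zero,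
    Pi.zero_apply] at hi
  split_ifs at hi with hd
  · rwa [hz _ (by simp only; omega), add_zero] at hi
  · rwa [add_zero] at hi

/-- If the other signal is the stronger one, a level of it is zero where the output vanishes and
the corresponding level of the own signal, if there is one, does. -/
theorem other_level_eq_zero {n m : ℕ} {x z : Signal (max n m)} (h : receive n m x z = 0)
    (hnm : n ≤ m) (i : Fin (max n m))
    (hx : ∀ j : Fin (max n m), (j : ℕ) + (m - n) = i → x j = 0) : z i = 0 := by
  have hi := congrFun h i
  have h0 : max n m - m = 0 := by omega
  simp only [receive, shift, Pi.add_apply, h0, Nat.zero_le, if_true, Nat.sub_zero,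
    Pi.zero_apply] at hi
  split_ifs at hi with hd
  · rwa [hx _ (by simp only; omega), zero_add] at hi
  · rwa [zero_add] at hi

namespace RelayScheme

variable {n m : ℕ}

/-- There is a relay scheme without decoding errors that sends `a` bits of message 1 and `b` bits
of message 2 per block, apart from the silent blocks. -/
def Sends (n m a b : ℕ) : Prop :=
  ∃ S : RelayScheme n m, S.k₁ = a ∧ S.k₂ + S.r = b ∧ ∀ L, (S.code L).ErrorFree

theorem sends_zero_zero : Sends n m 0 0 :=
  exists_errorFree (k₁ := 0) (k₂ := 0) (r := 0) (fun _ => none) (fun _ => none)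
    .forward .forward (fun _ _ t => t.elim0)
    (fun _ _ _ => ⟨funext fun t => t.elim0, funext fun t => t.elim0⟩)
    (fun _ _ _ => ⟨funext fun t => (t.elim Fin.elim0 Fin.elim0), funext fun t => t.elim0⟩)

/-- Transmitter 1 alone uses the channel. -/
theorem sends_n_zero : Sends n m n 0 := by
  refine exists_errorFree (k₁ := n) (k₂ := 0) (r := 0)
    (fun i => if h : (i : ℕ) < n then some (.inl ⟨i, h⟩) else none) (fun _ => none)
    .forward .forward (fun _ _ t => t.elim0) ?_
    (fun _ _ _ => ⟨funext fun t => (t.elim Fin.elim0 Fin.elim0), funext fun t => t.elim0⟩)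
  rintro ⟨a, ρ, b⟩ h hk
  refine ⟨funext fun t => ?_, funext fun t => t.elim0⟩
  have h1 := own_eq_zero h (fun i _ => fill_of_eq_none _ rfl) ⟨t, by omega⟩ t.isLt
  rwa [fill_of_eq_some _ (s := .inl t) (by simp)] at h1

/-- Transmitter 2 alone uses the channel, on its direct path. -/
theorem sends_zero_n : Sends n m 0 n := by
  refine exists_errorFree (k₁ := 0) (k₂ := n) (r := 0)
    (fun _ => none) (fun i => if h : (i : ℕ) < n then some (.inl ⟨i, h⟩) else none)
    .forward .forward (fun _ _ t => t.elim0)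
    (fun _ _ _ => ⟨funext fun t => t.elim0, funext fun t => t.elim0⟩) ?_
  rintro ⟨a, ρ, b⟩ h hk
  refine ⟨funext fun t => ?_, funext fun t => t.elim0⟩
  rcases t with t | t
  · have h1 := own_eq_zero h (fun i _ => fill_of_eq_none _ rfl) ⟨t, by omega⟩ t.isLt
    rwa [fill_of_eq_some _ (s := .inl t) (by simp)] at h1
  · exact t.elim0

/-- The bits on the lowest `m - n` levels of transmitter 2, which receiver 2 does not see, are
relayed to it on the top levels of transmitter 1. -/
theorem sends_zero_m (hnm : n ≤ m) : Sends n m 0 m := by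
  have hs : n + (m - n) = m := by omega
  suffices h : Sends n m 0 (n + (m - n)) by rwa [hs] at h
  refine exists_errorFree (n := n) (m := m) (k₁ := 0) (k₂ := n) (r := m - n)
    (fun i => if h : (i : ℕ) < m - n then some (.inr ⟨i, h⟩) else none)
    (fun i => if h : (i : ℕ) < n then some (.inl ⟨i, h⟩) else some (.inr ⟨i - n, by omega⟩))
    .forward .backward ?_ ?_ ?_
  · intro b h t
    rw [shift_eq_zero_iff (le_max_right n m)] at h
    have h1 := h ⟨n + t, by omega⟩ (by simp only; omega)
    rwa [fill_of_eq_some _ (s := .inr t) (by simp)] at h1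
  · rintro ⟨a, ρ, b⟩ h hk
    refine ⟨funext fun t => t.elim0, funext fun t => ?_⟩
    have h1 := other_eq_zero h (fun i _ => ?_) ⟨n + t, by omega⟩ (by simp only; omega)
    · rwa [fill_of_eq_some _ (s := .inr t) (by simp)] at h1
    · by_cases hi : (i : ℕ) < m - n
      · rw [fill_of_eq_some _ (s := .inr ⟨i, hi⟩) (by simp [hi])]
        exact congrFun hk _
      · exact fill_of_eq_none _ (by simp [hi])
  · rintro ⟨a, ρ, b⟩ h hk
    have hρ : ∀ t, ρ t = 0 := by
      intro t
      have h1 := other_level_eq_zero h hnm ⟨t, by omega⟩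
        (fun j hj => absurd hj (by simp only; omega))
      rwa [fill_of_eq_some _ (s := .inr t) (by simp)] at h1
    refine ⟨funext fun s => ?_, funext hρ⟩
    rcases s with t | t
    · have h1 := own_eq_zero h (fun i _ => ?_) ⟨t, by omega⟩ t.isLt
      · rwa [fill_of_eq_some _ (s := .inl t) (by simp)] at h1
      · by_cases hi : (i : ℕ) < m - n
        · rw [fill_of_eq_some _ (s := .inr ⟨i, hi⟩) (by simp [hi])]
          exact hρ _
        · exact fill_of_eq_none _ (by simp [hi])
    · exact congrFun hk t

/-- Transmitter 2 reaches receiver 1 on the `m - n` levels above the signal of transmitter 1; the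
latter relays the bits on its `m - n` lowest levels, which only receiver 2 sees. -/
theorem sends_n_sub (hnm : n ≤ m) : Sends n m n (m - n) := by
  have hs : 0 + (m - n) = m - n := by omega
  suffices h : Sends n m n (0 + (m - n)) by rwa [hs] at h
  refine exists_errorFree (n := n) (m := m)
    (k₁ := n) (k₂ := 0) (r := m - n)
    (fun i => if h : (i : ℕ) < n then some (.inl ⟨i, h⟩) else some (.inr ⟨i - n, by omega⟩))
    (fun i => if h : (i : ℕ) < m - n then some (.inr ⟨i, h⟩) else none)
    .forward .backward ?_ ?_ ?_
  · intro b h t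
    rw [shift_eq_zero_iff (le_max_right n m)] at h
    have h1 := h ⟨t, by omega⟩ (by simp only; omega)
    rwa [fill_of_eq_some _ (s := .inr t) (by simp)] at h1
  · rintro ⟨a, ρ, b⟩ h hk
    have hb : ∀ t, b (.inr t) = 0 := by
      intro t
      have h1 := other_level_eq_zero h hnm ⟨t, by omega⟩
        (fun j hj => absurd hj (by simp only; omega))
      rwa [fill_of_eq_some _ (s := .inr t) (by simp)] at h1
    refine ⟨funext fun t => ?_, funext hb⟩
    have h1 := own_eq_zero h (fun i _ => ?_) ⟨t, by omega⟩ t.isLt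
    · rwa [fill_of_eq_some _ (s := .inl t) (by simp)] at h1
    · by_cases hi : (i : ℕ) < m - n
      · rw [fill_of_eq_some _ (s := .inr ⟨i, hi⟩) (by simp [hi])]
        exact hb _
      · exact fill_of_eq_none _ (by simp [hi])
  · rintro ⟨a, ρ, b⟩ h hk
    refine ⟨funext (Sum.rec (fun t => t.elim0) (congrFun hk)), funext fun t => ?_⟩
    have h1 := other_eq_zero h (fun i _ => ?_) ⟨n + t, by omega⟩ (by simp only; omega)
    · rwa [fill_of_eq_some _ (s := .inr t) (by simp)] at h1
    · by_cases hi : (i : ℕ) < m - n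
      · rw [fill_of_eq_some _ (s := .inr ⟨i, hi⟩) (by simp [hi])]
        exact congrFun hk _
      · exact fill_of_eq_none _ (by simp [hi])

/-- The bits that disturb receiver 1 are relayed on the top `m` levels of transmitter 1: receiver
1 learns them from the following block, and receiver 2 already knows them. -/
theorem sends_sub_n (hmn : m ≤ n) : Sends n m (n - m) n := by
  have hs : n - m + m = n := by omega
  suffices h : Sends n m (n - m) (n - m + m) by rwa [hs] at h
  refine exists_errorFree (n := n) (m := m)
    (k₁ := n - m) (k₂ := n - m) (r := m)
    (fun i => if h : (i : ℕ) < m then some (.inr ⟨i, h⟩) else some (.inl ⟨i - m, by omega⟩))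
    (fun i => if h : (i : ℕ) < m then some (.inr ⟨i, h⟩) else some (.inl ⟨i - m, by omega⟩))
    .backward .forward ?_ ?_ ?_
  · intro b h t
    rw [shift_eq_zero_iff (le_max_right n m)] at h
    have h1 := h ⟨t, by omega⟩ t.isLt
    rwa [fill_of_eq_some _ (s := .inr t) (by simp)] at h1
  · rintro ⟨a, ρ, b⟩ h hk
    have h1 := own_eq_zero h (fun i hi => ?_)
    · refine ⟨funext fun t => ?_, funext fun t => ?_⟩
      · have h2 := h1 ⟨m + t, by omega⟩ (by simp only; omega)
        rwa [fill_of_eq_some _ (s := .inl t) (by simp)] at h2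
      · have h2 := h1 ⟨t, by omega⟩ (by simp only; omega)
        rwa [fill_of_eq_some _ (s := .inr t) (by simp)] at h2
    · rw [fill_of_eq_some _ (s := .inr ⟨i, hi⟩) (by simp [hi])]
      exact congrFun hk _
  · rintro ⟨a, ρ, b⟩ h hk
    have h1 := own_eq_zero h (fun i hi => ?_)
    · have hb : ∀ s, b s = 0 := by
        rintro (t | t)
        · have h2 := h1 ⟨m + t, by omega⟩ (by simp only; omega)
          rwa [fill_of_eq_some _ (s := .inl t) (by simp)] at h2
        · have h2 := h1 ⟨t, by omega⟩ (by simp only; omega)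
          rwa [fill_of_eq_some _ (s := .inr t) (by simp)] at h2
      exact ⟨funext hb, funext fun t => hb (.inr t)⟩
    · rw [fill_of_eq_some _ (s := .inr ⟨i, hi⟩) (by simp [hi])]
      exact congrFun hk _

/-- With weak interference, transmitter 2 uses only the levels that neither disturb receiver 1
nor are disturbed at receiver 2. -/
theorem sends_n_sub_two_mul (hmn : 2 * m ≤ n) : Sends n m n (n - 2 * m) := by
  refine exists_errorFree (k₁ := n) (k₂ := n - 2 * m) (r := 0)
    (fun i => some (.inl ⟨i, by omega⟩))
    (fun i => if h : m ≤ (i : ℕ) ∧ (i : ℕ) < n - m then some (.inl ⟨i - m, by omega⟩) else none)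
    .forward .forward (fun _ _ t => t.elim0) ?_ ?_
  · rintro ⟨a, ρ, b⟩ h hk
    refine ⟨funext fun t => ?_, funext fun t => t.elim0⟩
    have h1 := own_eq_zero h (fun i hi => fill_of_eq_none _ (by simp [hi.not_ge]))
      ⟨t, by omega⟩ t.isLt
    rwa [fill_of_eq_some _ (s := Sum.inl t) rfl] at h1
  · rintro ⟨a, ρ, b⟩ h hk
    refine ⟨funext fun s => ?_, funext fun t => t.elim0⟩
    rcases s with t | t
    · have h1 := own_level_eq_zero h (by omega) ⟨m + t, by omega⟩
        (fun j hj => absurd hj (by simp only; omega))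
      rwa [fill_of_eq_some _ (s := .inl t) (by
        have : m + (t : ℕ) < n - m := by omega
        simp [this])] at h1
    · exact t.elim0

/-- With `d = n - m ≤ m`, transmitter 2 sends `d` relay bits on its top levels, undisturbed at
receiver 2, and `d` fresh bits on its lowest levels, not seen by receiver 1. Only relayed bits
disturb the latter at receiver 2, which knows them from the preceding block; receiver 1 learns the
relay bits that disturb it from the following block. -/
theorem sends_m_two_mul (hmn : m ≤ n) (hnm : n ≤ 2 * m) : Sends n m m (2 * (n - m)) := by
  have hs : n - m + (n - m) = 2 * (n - m) := by omega
  suffices h : Sends n m m (n - m + (n - m)) by rwa [hs] at h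
  refine exists_errorFree (n := n) (m := m)
    (k₁ := m) (k₂ := n - m) (r := n - m)
    (fun i => if h : (i : ℕ) < m - (n - m) then some (.inl ⟨i, by omega⟩) else
      if h' : (i : ℕ) < m then some (.inr ⟨i - (m - (n - m)), by omega⟩)
      else some (.inl ⟨i - (n - m), by omega⟩))
    (fun i => if h : (i : ℕ) < n - m then some (.inr ⟨i, h⟩) else
      if h' : (i : ℕ) < m then none else some (.inl ⟨i - m, by omega⟩))
    .backward .forward ?_ ?_ ?_
  · intro b h t
    rw [shift_eq_zero_iff (le_max_right n m)] at h
    have h1 := h ⟨t, by omega⟩ (by simp only; omega)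
    rwa [fill_of_eq_some _ (s := .inr t) (by simp)] at h1
  · rintro ⟨a, ρ, b⟩ h hk
    have h1 := own_eq_zero h (fun i hi => ?_)
    · refine ⟨funext fun t => ?_, funext fun t => ?_⟩
      · by_cases ht : (t : ℕ) < m - (n - m)
        · have h2 := h1 ⟨t, by omega⟩ (by simp only; omega)
          rwa [fill_of_eq_some _ (s := .inl t) (by simp [ht])] at h2
        · have h2 := h1 ⟨n - m + t, by omega⟩ (by simp only; omega)
          have c1 : ¬ (n - m + (t : ℕ) < m - (n - m)) := by omega
          have c2 : ¬ (n - m + (t : ℕ) < m) := by omega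
          rwa [fill_of_eq_some _ (s := .inl t) (by simp [c1, c2])] at h2
      · have h2 := h1 ⟨m - (n - m) + t, by omega⟩ (by simp only; omega)
        have c2 : m - (n - m) + (t : ℕ) < m := by omega
        rwa [fill_of_eq_some _ (s := .inr t) (by simp [c2])] at h2
    · by_cases hd : (i : ℕ) < n - m
      · rw [fill_of_eq_some _ (s := .inr ⟨i, hd⟩) (by simp [hd])]
        exact congrFun hk _
      · exact fill_of_eq_none _ (by simp [hi, hd])
  · rintro ⟨a, ρ, b⟩ h hk
    have hb : ∀ s, b s = 0 := by
      rintro (t | t)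
      · have h1 := own_level_eq_zero h hmn ⟨m + t, by omega⟩ (fun j hj => ?_)
        · have c1 : ¬ (m + (t : ℕ) < n - m) := by omega
          rwa [fill_of_eq_some _ (s := .inl t) (by simp [c1])] at h1
        · simp only at hj
          have c1 : ¬ ((j : ℕ) < m - (n - m)) := by omega
          have c2 : (j : ℕ) < m := by omega
          rw [fill_of_eq_some _ (s := .inr ⟨j - (m - (n - m)), by omega⟩) (by simp [c1, c2])]
          exact congrFun hk _
      · have h1 := own_level_eq_zero h hmn ⟨t, by omega⟩
          (fun j hj => absurd hj (by simp only; omega))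
        rwa [fill_of_eq_some _ (s := .inr t) (by simp)] at h1
    exact ⟨funext hb, funext fun t => hb (.inr t)⟩

end RelayScheme

/-! ### Time sharing -/

namespace Code

variable {n m N N' : ℕ} {M₁ M₂ M₁' M₂' : Type}

/-- The code with renamed messages; `f₁` and `f₂` embed the new messages into the old ones. -/
def rename (c : Code n m N M₁ M₂) (f₁ : M₁' → M₁) (f₂ : M₂' → M₂) (g₁ : M₁ → M₁')
    (g₂ : M₂ → M₂') : Code n m N M₁' M₂' where
  enc₁ j w past := c.enc₁ j (f₁ w) past
  enc₂ j w := c.enc₂ j (f₂ w)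
  dec₁ y := g₁ (c.dec₁ y)
  dec₂ y := g₂ (c.dec₂ y)

theorem rename_out₁ (c : Code n m N M₁ M₂) (f₁ : M₁' → M₁) (f₂ : M₂' → M₂) (g₁ : M₁ → M₁')
    (g₂ : M₂ → M₂') (w₁ : M₁') (w₂ : M₂') (j : ℕ) (hj : j < N) :
    (c.rename f₁ f₂ g₁ g₂).out₁ w₁ w₂ ⟨j, hj⟩ = c.out₁ (f₁ w₁) (f₂ w₂) ⟨j, hj⟩ := by
  induction j using Nat.strong_induction_on with
  | _ j ih =>
    rw [out₁, out₁]
    simp only [rename]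
    congr 2
    exact funext fun i => ih i i.isLt _

theorem ErrorFree.rename {c : Code n m N M₁ M₂} (hc : c.ErrorFree) {f₁ : M₁' → M₁}
    {f₂ : M₂' → M₂} {g₁ : M₁ → M₁'} {g₂ : M₂ → M₂'} (h₁ : Function.LeftInverse g₁ f₁)
    (h₂ : Function.LeftInverse g₂ f₂) : (c.rename f₁ f₂ g₁ g₂).ErrorFree := by
  intro w₁ w₂
  have ho₁ : (c.rename f₁ f₂ g₁ g₂).out₁ w₁ w₂ = c.out₁ (f₁ w₁) (f₂ w₂) :=
    funext fun j => c.rename_out₁ f₁ f₂ g₁ g₂ w₁ w₂ j j.isLt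
  have ho₂ : (c.rename f₁ f₂ g₁ g₂).out₂ w₁ w₂ = c.out₂ (f₁ w₁) (f₂ w₂) := by
    funext j
    rw [out₂, out₂, in₁, in₁, ho₁]
    rfl
  rw [ho₁, ho₂]
  exact ⟨(congrArg g₁ (hc _ _).1).trans (h₁ w₁), (congrArg g₂ (hc _ _).2).trans (h₂ w₂)⟩

/-- The code that uses two codes one after the other. -/
def append (c : Code n m N M₁ M₂) (c' : Code n m N' M₁' M₂') :
    Code n m (N + N') (M₁ × M₁') (M₂ × M₂') where
  enc₁ j w past :=
    if h : (j : ℕ) < N then c.enc₁ ⟨j, h⟩ w.1 past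
    else c'.enc₁ ⟨j - N, by omega⟩ w.2 fun i =>
      past ⟨N + i, by have := i.isLt; simp only at this; omega⟩
  enc₂ j w :=
    if h : (j : ℕ) < N then c.enc₂ ⟨j, h⟩ w.1 else c'.enc₂ ⟨j - N, by omega⟩ w.2
  dec₁ y := (c.dec₁ fun j => y (Fin.castAdd N' j), c'.dec₁ fun j => y (Fin.natAdd N j))
  dec₂ y := (c.dec₂ fun j => y (Fin.castAdd N' j), c'.dec₂ fun j => y (Fin.natAdd N j))

variable (c : Code n m N M₁ M₂) (c' : Code n m N' M₁' M₂') (w₁ : M₁ × M₁') (w₂ : M₂ × M₂')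

theorem append_out₁_castAdd (j : ℕ) (hj : j < N) :
    (c.append c').out₁ w₁ w₂ (Fin.castAdd N' ⟨j, hj⟩) = c.out₁ w₁.1 w₂.1 ⟨j, hj⟩ := by
  induction j using Nat.strong_induction_on with
  | _ j ih =>
    rw [out₁, out₁]
    simp only [append, Fin.val_castAdd, hj, dif_pos]
    congr 2
    exact funext fun i => ih i i.isLt _

theorem append_enc₁_natAdd (j : Fin N') (past : Fin (N + j) → Signal (max n m)) :
    (c.append c').enc₁ (Fin.natAdd N j) w₁ past =
      c'.enc₁ j w₁.2 fun i => past ⟨N + i, by omega⟩ := by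
  -- In the definition of `append` the time is `N + j - N`, on which the type of `past` depends.
  have key : ∀ (k : Fin N') (hk : k = j) (f : Fin k → Signal (max n m)),
      (∀ i : Fin k, f i = past ⟨N + i, by have := i.isLt; subst hk; omega⟩) →
      c'.enc₁ k w₁.2 f = c'.enc₁ j w₁.2 fun i => past ⟨N + i, by omega⟩ := by
    rintro k rfl f hf
    exact congrArg _ (funext hf)
  simp only [append, Fin.val_natAdd, Nat.not_lt.2 (Nat.le_add_right N j), dif_neg,
    not_false_eq_true]
  exact key _ (Fin.ext (by simp)) _ fun i => rfl

theorem append_enc₂_natAdd (j : Fin N') :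
    (c.append c').enc₂ (Fin.natAdd N j) w₂ = c'.enc₂ j w₂.2 := by
  simp [append]

theorem append_out₁_natAdd (j : ℕ) (hj : j < N') :
    (c.append c').out₁ w₁ w₂ (Fin.natAdd N ⟨j, hj⟩) = c'.out₁ w₁.2 w₂.2 ⟨j, hj⟩ := by
  induction j using Nat.strong_induction_on with
  | _ j ih =>
    rw [out₁, out₁, append_enc₂_natAdd, append_enc₁_natAdd]
    congr 2
    exact funext fun i => ih i i.isLt _

theorem append_out₂_castAdd (j : Fin N) :
    (c.append c').out₂ w₁ w₂ (Fin.castAdd N' j) = c.out₂ w₁.1 w₂.1 j := by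
  rw [out₂, out₂, in₁, in₁]
  simp only [append, Fin.val_castAdd, j.isLt, dif_pos]
  congr 2
  exact funext fun i => c.append_out₁_castAdd c' w₁ w₂ i _

theorem append_out₂_natAdd (j : Fin N') :
    (c.append c').out₂ w₁ w₂ (Fin.natAdd N j) = c'.out₂ w₁.2 w₂.2 j := by
  rw [out₂, out₂, in₁, in₁, append_enc₂_natAdd, append_enc₁_natAdd]
  congr 2
  exact funext fun i => c.append_out₁_natAdd c' w₁ w₂ i _

variable {c c'}

theorem ErrorFree.append (hc : c.ErrorFree) (hc' : c'.ErrorFree) : (c.append c').ErrorFree := by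
  intro w₁ w₂
  refine ⟨Prod.ext ?_ ?_, Prod.ext ?_ ?_⟩
  · refine Eq.trans (congrArg c.dec₁ (funext fun j => ?_)) (hc w₁.1 w₂.1).1
    exact c.append_out₁_castAdd c' w₁ w₂ j j.isLt
  · refine Eq.trans (congrArg c'.dec₁ (funext fun j => ?_)) (hc' w₁.2 w₂.2).1
    exact c.append_out₁_natAdd c' w₁ w₂ j j.isLt
  · refine Eq.trans (congrArg c.dec₂ (funext fun j => ?_)) (hc w₁.1 w₂.1).2
    exact c.append_out₂_castAdd c' w₁ w₂ j
  · refine Eq.trans (congrArg c'.dec₂ (funext fun j => ?_)) (hc' w₁.2 w₂.2).2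
    exact c.append_out₂_natAdd c' w₁ w₂ j

theorem ErrorFree.errProb₁_eq_zero (hc : c.ErrorFree) : c.errProb₁ = 0 := by
  have : IsEmpty {w : M₁ × M₂ // c.dec₁ (c.out₁ w.1 w.2) ≠ w.1} := ⟨fun w => w.2 (hc _ _).1⟩
  simp [errProb₁]

theorem ErrorFree.errProb₂_eq_zero (hc : c.ErrorFree) : c.errProb₂ = 0 := by
  have : IsEmpty {w : M₁ × M₂ // c.dec₂ (c.out₂ w.1 w.2) ≠ w.2} := ⟨fun w => w.2 (hc _ _).2⟩
  simp [errProb₂]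

end Code

/-- There is an error-free code of length `N` for messages of `a` and `b` bits. -/
def Carries (n m N a b : ℕ) : Prop :=
  ∃ c : Code n m N (Fin (2 ^ a)) (Fin (2 ^ b)), c.ErrorFree

theorem Carries.of_errorFree {n m N a b : ℕ} {M₁ M₂ : Type} [Fintype M₁] [Fintype M₂]
    (c : Code n m N M₁ M₂) (hc : c.ErrorFree) (h₁ : Fintype.card M₁ = 2 ^ a)
    (h₂ : Fintype.card M₂ = 2 ^ b) : Carries n m N a b := by
  let e₁ := Fintype.equivFinOfCardEq h₁
  let e₂ := Fintype.equivFinOfCardEq h₂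
  exact ⟨_, hc.rename e₁.apply_symm_apply e₂.apply_symm_apply⟩

theorem Carries.add {n m N a b N' a' b' : ℕ} (h : Carries n m N a b)
    (h' : Carries n m N' a' b') : Carries n m (N + N') (a + a') (b + b') := by
  obtain ⟨c, hc⟩ := h
  obtain ⟨c', hc'⟩ := h'
  exact Carries.of_errorFree _ (hc.append hc') (by simp [pow_add]) (by simp [pow_add])

theorem Carries.silent (n m N : ℕ) : Carries n m N 0 0 :=
  ⟨⟨fun _ _ _ => 0, fun _ _ => 0, fun _ => 0, fun _ => 0⟩,
    fun _ _ => ⟨Subsingleton.elim (α := Fin 1) _ _, Subsingleton.elim (α := Fin 1) _ _⟩⟩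

theorem Carries.mul {n m N a b : ℕ} (h : Carries n m N a b) (k : ℕ) :
    Carries n m (k * N) (k * a) (k * b) := by
  induction k with
  | zero => simpa using Carries.silent n m 0
  | succ k ih => simpa only [Nat.succ_mul] using ih.add h

/-- The rate pairs of error-free codes. -/
def errorFreeRates (n m : ℕ) : Set (ℝ × ℝ) :=
  {R | ∃ N a b : ℕ, 0 < N ∧ Carries n m N a b ∧ R = ((a : ℝ) / N, (b : ℝ) / N)}

theorem RelayScheme.rates_mem {n m : ℕ} (S : RelayScheme n m)
    (hS : ∀ L, (S.code L).ErrorFree) (L : ℕ) : (S.code L).rates ∈ errorFreeRates n m := by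
  refine ⟨L + 1, S.k₁ * L, (S.k₂ + S.r) * L, L.succ_pos,
    Carries.of_errorFree _ (hS L) (by simp [ZMod.card, pow_mul])
      (by simp [ZMod.card, pow_mul]), S.rates_eq L⟩

theorem combination_mem_errorFreeRates {n m : ℕ} {x y : ℝ × ℝ} (hx : x ∈ errorFreeRates n m)
    (hy : y ∈ errorFreeRates n m) {p q : ℕ} (hpq : 0 < p + q) :
    ((p : ℝ) / (p + q : ℕ)) • x + ((q : ℝ) / (p + q : ℕ)) • y ∈ errorFreeRates n m := by
  obtain ⟨N, a, b, hN, hc, rfl⟩ := hx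
  obtain ⟨N', a', b', hN', hc', rfl⟩ := hy
  refine ⟨p * N' * N + q * N * N', p * N' * a + q * N * a', p * N' * b + q * N * b', ?_,
    (hc.mul _).add (hc'.mul _), ?_⟩
  · rw [mul_right_comm p, ← add_mul, ← add_mul]
    positivity
  · have h1 : (N : ℝ) ≠ 0 := by positivity
    have h2 : (N' : ℝ) ≠ 0 := by positivity
    have h3 : ((p + q : ℕ) : ℝ) ≠ 0 := by positivity
    have h4 : ((p * N' * N + q * N * N' : ℕ) : ℝ) = (p + q : ℕ) * N * N' := by
      push_cast; ring
    rw [h4]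
    push_cast at h3 ⊢
    refine Prod.ext ?_ ?_ <;> simp only [Prod.fst_add, Prod.snd_add, Prod.smul_fst,
      Prod.smul_snd, smul_eq_mul] <;> field_simp

theorem convex_closure_errorFreeRates (n m : ℕ) : Convex ℝ (closure (errorFreeRates n m)) := by
  rw [convex_iff_forall_pos]
  intro x hx y hy s t hs ht hst
  -- Weights `⌊s k⌋ / k` and `(k - ⌊s k⌋) / k` approximate `s` and `t`.
  have hlim : Filter.Tendsto (fun k : ℕ => (⌊s * k⌋₊ : ℝ) / k) Filter.atTop (nhds s) :=
    (tendsto_nat_floor_mul_div_atTop hs.le).comp tendsto_natCast_atTop_atTop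
  have hlim' : Filter.Tendsto
      (fun k : ℕ => ((⌊s * k⌋₊ : ℝ) / k) • x + (1 - (⌊s * k⌋₊ : ℝ) / k) • y) Filter.atTop
      (nhds (s • x + t • y)) := by
    rw [eq_sub_of_add_eq' hst]
    exact (hlim.smul_const x).add ((hlim.const_sub 1).smul_const y)
  refine isClosed_closure.mem_of_tendsto hlim' ?_
  filter_upwards [Filter.eventually_gt_atTop 0] with k hk
  have hle : ⌊s * k⌋₊ ≤ k := by
    refine Nat.floor_le_of_le ?_
    exact mul_le_of_le_one_left (Nat.cast_nonneg k) (by linarith)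
  have hk' : (k : ℝ) ≠ 0 := by positivity
  obtain ⟨q, hq⟩ := Nat.exists_eq_add_of_le hle
  generalize ⌊s * k⌋₊ = p at hq
  subst hq
  have h1 : 1 - (p : ℝ) / (p + q : ℕ) = (q : ℝ) / (p + q : ℕ) := by
    rw [eq_div_iff hk', sub_mul, div_mul_cancel₀ _ hk']
    push_cast; ring
  rw [h1]
  refine map_mem_closure₂ (f := fun x y : ℝ × ℝ =>
    ((p : ℝ) / (p + q : ℕ)) • x + ((q : ℝ) / (p + q : ℕ)) • y) (by fun_prop) hx hy ?_
  exact fun x hx y hy => combination_mem_errorFreeRates hx hy hk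

/-- Rates slightly below those of an error-free code are achievable at all lengths: repeat the
code and leave a rest of bounded length unused. -/
theorem achievable_smul {n m N a b : ℕ} (hN : 0 < N) (h : Carries n m N a b) {δ : ℝ}
    (hδ : 0 ≤ δ) (hδ1 : δ < 1) : Achievable n m (δ • ((a : ℝ) / N, (b : ℝ) / N)) := by
  have hN' : (0 : ℝ) < N := by exact_mod_cast hN
  have hfloor : ∀ M k a : ℕ, δ * M ≤ k * N →
      ⌊(2 : ℝ) ^ ((M : ℝ) * (δ * (a / N)))⌋₊ ≤ 2 ^ (k * a) := by
    intro M k a hk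
    refine Nat.floor_le_of_le ?_
    push_cast
    rw [← Real.rpow_natCast]
    refine Real.rpow_le_rpow_of_exponent_le one_le_two ?_
    calc (M : ℝ) * (δ * (a / N)) = (δ * M) * (a / N) := by ring
      _ ≤ (k * N) * (a / N) := by gcongr
      _ = (k * a : ℕ) := by push_cast; field_simp
  have hpos₁ : 0 ≤ δ * ((a : ℝ) / N) := by positivity
  have hpos₂ : 0 ≤ δ * ((b : ℝ) / N) := by positivity
  have hex : ∀ M : ℕ, ∃ c : Code n m M (Message M (δ * (a / N))) (Message M (δ * (b / N))),
      δ * M ≤ (M / N : ℕ) * N → c.ErrorFree := by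
    intro M
    have z₁ : Message M (δ * (a / N)) := ⟨0, one_le_floor_message M hpos₁⟩
    have z₂ : Message M (δ * (b / N)) := ⟨0, one_le_floor_message M hpos₂⟩
    by_cases hM : δ * M ≤ (M / N : ℕ) * N
    · obtain ⟨c, hc⟩ : Carries n m M (M / N * a) (M / N * b) := by
        have := (h.mul (M / N)).add (Carries.silent n m (M % N))
        rwa [mul_comm (M / N) N, Nat.div_add_mod] at this
      have : Nonempty (Message M (δ * (a / N))) := ⟨z₁⟩
      have : Nonempty (Message M (δ * (b / N))) := ⟨z₂⟩
      exact ⟨_, fun _ => hc.rename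
        (Function.leftInverse_invFun (Fin.castLE_injective (hfloor M _ a hM)))
        (Function.leftInverse_invFun (Fin.castLE_injective (hfloor M _ b hM)))⟩
    · exact ⟨⟨fun _ _ _ => 0, fun _ _ => 0, fun _ => z₁, fun _ => z₂⟩, fun h => absurd h hM⟩
  choose c hc using hex
  refine ⟨hpos₁, hpos₂, c, tendsto_const_nhds.congr' ?_⟩
  -- The unused rest, shorter than `N`, does not matter once `N ≤ (1 - δ) M`.
  obtain ⟨K, hK⟩ := exists_nat_gt (N / (1 - δ))
  filter_upwards [Filter.eventually_ge_atTop K] with M hM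
  have hM' : (K : ℝ) ≤ M := by exact_mod_cast hM
  have hfree : (c M).ErrorFree := by
    refine hc M ?_
    have h1 : (M : ℝ) = (M / N : ℕ) * N + (M % N : ℕ) := by
      exact_mod_cast (Nat.div_add_mod' M N).symm
    have h2 : ((M % N : ℕ) : ℝ) ≤ N := by exact_mod_cast (Nat.mod_lt M hN).le
    rw [div_lt_iff₀ (by linarith)] at hK
    nlinarith
  rw [hfree.errProb₁_eq_zero, hfree.errProb₂_eq_zero, max_self]

theorem closure_errorFreeRates_subset (n m : ℕ) :
    closure (errorFreeRates n m) ⊆ capacityRegion n m := by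
  refine closure_minimal ?_ isClosed_closure
  rintro R ⟨N, a, b, hN, hc, rfl⟩
  have hlim : Filter.Tendsto (fun δ : ℝ => δ • ((a : ℝ) / N, (b : ℝ) / N))
      (nhdsWithin 1 (Set.Ico 0 1)) (nhds ((a : ℝ) / N, (b : ℝ) / N)) := by
    have h : Continuous fun δ : ℝ => δ • ((a : ℝ) / N, (b : ℝ) / N) := by fun_prop
    simpa using (h.tendsto 1).mono_left nhdsWithin_le_nhds
  have hne : (nhdsWithin (1 : ℝ) (Set.Ico 0 1)).NeBot := by
    rw [← mem_closure_iff_nhdsWithin_neBot, closure_Ico zero_ne_one]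
    exact ⟨zero_le_one, le_rfl⟩
  refine mem_closure_of_tendsto hlim ?_
  filter_upwards [self_mem_nhdsWithin] with δ hδ
  exact achievable_smul hN hc hδ.1 hδ.2

/-! ### The corner points of the region -/

/-- It is impossible to move away from an extreme point in two opposite directions. -/
theorem false_of_mem_extremePoints {s : Set (ℝ × ℝ)} {P : ℝ × ℝ}
    (hP : P ∈ Set.extremePoints ℝ s) {v : ℝ × ℝ} (hv : v ≠ 0) {ε : ℝ} (hε : 0 < ε)
    (h₁ : P + ε • v ∈ s) (h₂ : P - ε • v ∈ s) : False := by
  have hseg : P ∈ openSegment ℝ (P + ε • v) (P - ε • v) :=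
    ⟨1 / 2, 1 / 2, by norm_num, by norm_num, by norm_num, by
      rw [← smul_add, add_add_sub_cancel, ← two_smul ℝ P, smul_smul]; norm_num⟩
  have h := hP.2 h₁ h₂ hseg
  rw [add_eq_left] at h
  exact (smul_ne_zero hε.ne' hv) h

/-- At an extreme point of the polygon each of the directions `(1, 0)`, `(0, 1)`, `(1, -1)` and
`(1, -2)` is blocked by a constraint that holds with equality. -/
theorem blocked_of_mem_extremePoints_polygon {A B C D x y : ℝ}
    (hP : (x, y) ∈ Set.extremePoints ℝ (polygon A B C D)) :
    (x = 0 ∨ x = A ∨ x + y = C ∨ 2 * x + y = D) ∧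
    (y = 0 ∨ y = B ∨ x + y = C ∨ 2 * x + y = D) ∧
    (x = 0 ∨ x = A ∨ y = 0 ∨ y = B ∨ 2 * x + y = D) ∧
    (x = 0 ∨ x = A ∨ y = 0 ∨ y = B ∨ x + y = C) := by
  obtain ⟨h1, h2, h3, h4, h5, h6⟩ := hP.1
  simp only at h1 h2 h3 h4 h5 h6
  refine ⟨?_, ?_, ?_, ?_⟩
  · by_contra! h
    obtain ⟨e1, e2, e3, e4⟩ := h
    have := h1.lt_of_ne' e1
    have := h3.lt_of_ne e2
    have := h5.lt_of_ne e3
    have := h6.lt_of_ne e4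
    obtain ⟨ε, hε, hlt⟩ := exists_between
      (show 0 < min (min x (A - x)) (min (C - (x + y)) ((D - (2 * x + y)) / 2)) by
        simp only [lt_min_iff]; refine ⟨⟨?_, ?_⟩, ?_, ?_⟩ <;> linarith)
    simp only [lt_min_iff] at hlt
    obtain ⟨⟨l1, l2⟩, l3, l4⟩ := hlt
    refine false_of_mem_extremePoints hP (v := (1, 0)) (by simp) hε ?_ ?_ <;>
      simp only [polygon, Set.mem_ofPred_eq, Prod.fst_add, Prod.snd_add, Prod.fst_sub,
        Prod.snd_sub, Prod.smul_mk, smul_eq_mul] <;>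
      refine ⟨?_, ?_, ?_, ?_, ?_, ?_⟩ <;> linarith
  · by_contra! h
    obtain ⟨e1, e2, e3, e4⟩ := h
    have := h2.lt_of_ne' e1
    have := h4.lt_of_ne e2
    have := h5.lt_of_ne e3
    have := h6.lt_of_ne e4
    obtain ⟨ε, hε, hlt⟩ := exists_between
      (show 0 < min (min y (B - y)) (min (C - (x + y)) (D - (2 * x + y))) by
        simp only [lt_min_iff]; refine ⟨⟨?_, ?_⟩, ?_, ?_⟩ <;> linarith)
    simp only [lt_min_iff] at hlt
    obtain ⟨⟨l1, l2⟩, l3, l4⟩ := hlt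
    refine false_of_mem_extremePoints hP (v := (0, 1)) (by simp) hε ?_ ?_ <;>
      simp only [polygon, Set.mem_ofPred_eq, Prod.fst_add, Prod.snd_add, Prod.fst_sub,
        Prod.snd_sub, Prod.smul_mk, smul_eq_mul] <;>
      refine ⟨?_, ?_, ?_, ?_, ?_, ?_⟩ <;> linarith
  · by_contra! h
    obtain ⟨e1, e2, e3, e4, e5⟩ := h
    have := h1.lt_of_ne' e1
    have := h3.lt_of_ne e2
    have := h2.lt_of_ne' e3
    have := h4.lt_of_ne e4
    have := h6.lt_of_ne e5
    obtain ⟨ε, hε, hlt⟩ := exists_between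
      (show 0 < min (min x (A - x)) (min (min y (B - y)) (D - (2 * x + y))) by
        simp only [lt_min_iff]; refine ⟨⟨?_, ?_⟩, ⟨?_, ?_⟩, ?_⟩ <;> linarith)
    simp only [lt_min_iff] at hlt
    obtain ⟨⟨l1, l2⟩, ⟨l3, l4⟩, l5⟩ := hlt
    refine false_of_mem_extremePoints hP (v := (1, -1)) (by simp) hε ?_ ?_ <;>
      simp only [polygon, Set.mem_ofPred_eq, Prod.fst_add, Prod.snd_add, Prod.fst_sub,
        Prod.snd_sub, Prod.smul_mk, smul_eq_mul] <;>
      refine ⟨?_, ?_, ?_, ?_, ?_, ?_⟩ <;> linarith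
  · by_contra! h
    obtain ⟨e1, e2, e3, e4, e5⟩ := h
    have := h1.lt_of_ne' e1
    have := h3.lt_of_ne e2
    have := h2.lt_of_ne' e3
    have := h4.lt_of_ne e4
    have := h5.lt_of_ne e5
    obtain ⟨ε, hε, hlt⟩ := exists_between
      (show 0 < min (min x (A - x)) (min (min (y / 2) ((B - y) / 2)) (C - (x + y))) by
        simp only [lt_min_iff]; refine ⟨⟨?_, ?_⟩, ⟨?_, ?_⟩, ?_⟩ <;> linarith)
    simp only [lt_min_iff] at hlt
    obtain ⟨⟨l1, l2⟩, ⟨l3, l4⟩, l5⟩ := hlt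
    refine false_of_mem_extremePoints hP (v := (1, -2)) (by simp) hε ?_ ?_ <;>
      simp only [polygon, Set.mem_ofPred_eq, Prod.fst_add, Prod.snd_add, Prod.fst_sub,
        Prod.snd_sub, Prod.smul_mk, smul_eq_mul] <;>
      refine ⟨?_, ?_, ?_, ?_, ?_, ?_⟩ <;> linarith

theorem isCompact_polygon (A B C D : ℝ) : IsCompact (polygon A B C D) := by
  refine (isCompact_Icc (a := ((0 : ℝ), (0 : ℝ)))
    (b := (A, B))).of_isClosed_subset (isClosed_polygon A B C D) ?_
  rintro ⟨x, y⟩ ⟨h1, h2, h3, h4, -, -⟩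
  exact ⟨⟨h1, h2⟩, h3, h4⟩

theorem convex_polygon (A B C D : ℝ) : Convex ℝ (polygon A B C D) := by
  have f : IsLinearMap ℝ (fun R : ℝ × ℝ => R.1) := (LinearMap.fst ℝ ℝ ℝ).isLinear
  have g : IsLinearMap ℝ (fun R : ℝ × ℝ => R.2) := (LinearMap.snd ℝ ℝ ℝ).isLinear
  have fg : IsLinearMap ℝ (fun R : ℝ × ℝ => R.1 + R.2) :=
    (LinearMap.fst ℝ ℝ ℝ + LinearMap.snd ℝ ℝ ℝ).isLinear
  have ffg : IsLinearMap ℝ (fun R : ℝ × ℝ => 2 * R.1 + R.2) :=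
    ((2 : ℝ) • LinearMap.fst ℝ ℝ ℝ + LinearMap.snd ℝ ℝ ℝ).isLinear
  exact (convex_halfSpace_ge f _).inter <| (convex_halfSpace_ge g _).inter <|
    (convex_halfSpace_le f _).inter <| (convex_halfSpace_le g _).inter <|
    (convex_halfSpace_le fg _).inter (convex_halfSpace_le ffg _)

/-- The extreme points are among at most five intersections of constraints, which depend on
whether the interference is strong (`n ≤ m`), weak (`2 m ≤ n`) or in between. -/
theorem sends_of_mem_extremePoints {n m : ℕ} {P : ℝ × ℝ}
    (hP : P ∈ Set.extremePoints ℝ (region n m)) :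
    ∃ a b : ℕ, P = ((a : ℝ), (b : ℝ)) ∧ RelayScheme.Sends n m a b := by
  obtain ⟨x, y⟩ := P
  obtain ⟨h1, h2, h3, h4, h5, h6⟩ := hP.1
  obtain ⟨b1, b2, b3, b4⟩ := blocked_of_mem_extremePoints_polygon hP
  simp only at h1 h2 h3 h4 h5 h6
  have hn : (0 : ℝ) ≤ n := n.cast_nonneg
  have hm : (0 : ℝ) ≤ m := m.cast_nonneg
  rcases le_total n m with h | h
  · have hc : (n : ℝ) ≤ m := by exact_mod_cast h
    rw [max_eq_right hc] at *
    rw [max_eq_right (sub_nonpos.2 hc)] at *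
    rw [max_eq_right (by linarith : (n : ℝ) - m ≤ m)] at *
    have key : (x = 0 ∧ y = 0) ∨ (x = n ∧ y = 0) ∨ (x = 0 ∧ y = m) ∨ (x = n ∧ y = m - n) := by
      clear hP
      grind
    rcases key with ⟨rfl, rfl⟩ | ⟨rfl, rfl⟩ | ⟨rfl, rfl⟩ | ⟨rfl, rfl⟩
    · exact ⟨0, 0, by simp, RelayScheme.sends_zero_zero⟩
    · exact ⟨n, 0, by simp, RelayScheme.sends_n_zero⟩
    · exact ⟨0, m, by simp, RelayScheme.sends_zero_m h⟩
    · exact ⟨n, m - n, by simp [h], RelayScheme.sends_n_sub h⟩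
  · have hc : (m : ℝ) ≤ n := by exact_mod_cast h
    rw [max_eq_left hc] at *
    rw [max_eq_left (sub_nonneg.2 hc)] at *
    rcases le_total (2 * m) n with h' | h'
    · have hc' : 2 * (m : ℝ) ≤ n := by exact_mod_cast h'
      rw [max_eq_left (by linarith : (m : ℝ) ≤ n - m)] at *
      have key : (x = 0 ∧ y = 0) ∨ (x = n ∧ y = 0) ∨ (x = 0 ∧ y = n) ∨
          (x = n - m ∧ y = n) ∨ (x = n ∧ y = n - 2 * m) := by
        clear hP
        grind
      rcases key with ⟨rfl, rfl⟩ | ⟨rfl, rfl⟩ | ⟨rfl, rfl⟩ | ⟨rfl, rfl⟩ | ⟨rfl, rfl⟩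
      · exact ⟨0, 0, by simp, RelayScheme.sends_zero_zero⟩
      · exact ⟨n, 0, by simp, RelayScheme.sends_n_zero⟩
      · exact ⟨0, n, by simp, RelayScheme.sends_zero_n⟩
      · exact ⟨n - m, n, by simp [h], RelayScheme.sends_sub_n h⟩
      · exact ⟨n, n - 2 * m, by simp [h'], RelayScheme.sends_n_sub_two_mul h'⟩
    · have hc' : (n : ℝ) ≤ 2 * m := by exact_mod_cast h'
      rw [max_eq_right (by linarith : (n : ℝ) - m ≤ m)] at *
      have key : (x = 0 ∧ y = 0) ∨ (x = n ∧ y = 0) ∨ (x = 0 ∧ y = n) ∨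
          (x = n - m ∧ y = n) ∨ (x = m ∧ y = 2 * (n - m)) := by
        clear hP
        grind
      rcases key with ⟨rfl, rfl⟩ | ⟨rfl, rfl⟩ | ⟨rfl, rfl⟩ | ⟨rfl, rfl⟩ | ⟨rfl, rfl⟩
      · exact ⟨0, 0, by simp, RelayScheme.sends_zero_zero⟩
      · exact ⟨n, 0, by simp, RelayScheme.sends_n_zero⟩
      · exact ⟨0, n, by simp, RelayScheme.sends_zero_n⟩
      · exact ⟨n - m, n, by simp [h], RelayScheme.sends_sub_n h⟩
      · exact ⟨m, 2 * (n - m), by simp [h], RelayScheme.sends_m_two_mul h h'⟩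

theorem exists_relayScheme_of_mem_extremePoints {n m : ℕ} {P : ℝ × ℝ}
    (hP : P ∈ Set.extremePoints ℝ (region n m)) :
    ∃ S : RelayScheme n m, (∀ L : ℕ, (S.code L).ErrorFree) ∧
      Filter.Tendsto (fun L : ℕ => (S.code L).rates) Filter.atTop (nhds P) := by
  obtain ⟨_, _, rfl, S, rfl, rfl, hS⟩ := sends_of_mem_extremePoints hP
  exact ⟨S, hS, S.tendsto_rates⟩

theorem region_subset_capacityRegion (n m : ℕ) : region n m ⊆ capacityRegion n m := by
  refine Set.Subset.trans ?_ (closure_errorFreeRates_subset n m)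
  rw [region, ← closure_convexHull_extremePoints (isCompact_polygon _ _ _ _)
    (convex_polygon _ _ _ _)]
  refine closure_minimal (convexHull_min ?_ (convex_closure_errorFreeRates n m)) isClosed_closure
  intro P hP
  obtain ⟨S, hS, hlim⟩ := exists_relayScheme_of_mem_extremePoints hP
  exact mem_closure_of_tendsto hlim (Filter.Eventually.of_forall (S.rates_mem hS))

theorem capacityRegion_eq (n m : ℕ) : capacityRegion n m = region n m :=
  (capacityRegion_subset_region n m).antisymm (region_subset_capacityRegion n m)

end FeedbackIC

theorem mainTheorem2 (n m : ℕ) :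
    FeedbackIC.capacityRegion n m =
        {R : ℝ × ℝ | 0 ≤ R.1 ∧ 0 ≤ R.2 ∧
          R.1 ≤ (n : ℝ) ∧
          R.2 ≤ max (n : ℝ) (m : ℝ) ∧
          R.1 + R.2 ≤ max ((n : ℝ) - (m : ℝ)) 0 + max (n : ℝ) (m : ℝ) ∧
          2 * R.1 + R.2 ≤ max ((n : ℝ) - (m : ℝ)) 0 + max (n : ℝ) (m : ℝ)
            + max ((n : ℝ) - (m : ℝ)) (m : ℝ)} ∧
      ∀ P ∈ Set.extremePoints ℝ (FeedbackIC.capacityRegion n m),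
        ∃ S : FeedbackIC.RelayScheme n m,
          (∀ L : ℕ, (S.code L).ErrorFree) ∧
          Filter.Tendsto (fun L : ℕ => (S.code L).rates) Filter.atTop (nhds P) := by
  refine ⟨FeedbackIC.capacityRegion_eq n m, fun P hP => ?_⟩
  rw [FeedbackIC.capacityRegion_eq] at hP
  exact FeedbackIC.exists_relayScheme_of_mem_extremePoints hP
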